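/- **Completeness of the RacerDX analysis.** *Language.* Fix a finite set $\mathsf{Field}$ of field names and variables, which are either formals $\mathtt{arg}_1,\mathtt{arg}_2,\dots$ or locals. Paths are $\pi ::= x.f\mid \pi.f$, expressions $e$ are variables or paths; $e\preccurlyeq e'$ means that $e'$ is $e$ followed by a (possibly empty) sequence of fields. Simple statements are $c ::= \mathtt{skip}\mid x:=y\mid x:=\pi\mid \pi:=x\mid x:=\mathtt{new}()\mid\mathtt{lock}()\mid\mathtt{unlock}()$, and compound programs are $C ::= c\mid C;c\mid C;\mathtt{if}(*)\,C_1\,C_2\mid C;\mathtt{while}(*)\,C'\mid C;\mathsf m(e_1,\dots,e_n)$. Each method $\mathsf m$ has an arity and a body (a compound program). Methods are non-recursive; calls respect arities; the body of an $n$-ary method mentions no $\mathtt{arg}_j$ with $j>n$ and uses no local variable before it is definitely assigned. A method is in *Argument-Normal Form* if its body contains no statement $\pi:=\mathtt{arg}_j$. *Balanced locking* of $C$ means: in every method body, branch and loop body $\mathtt{lock}()$ and $\mathtt{unlock}()$ occur in balanced pairs, and every $\mathtt{unlock}()$ in $C$ has a matching preceding $\mathtt{lock}()$. *Concrete semantics.*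 $\mathsf{Loc}$ is a countably infinite set with an element $\mathsf{nil}$; a stack frame is a map from variables to $\mathsf{Loc}$; a heap $h$ is a finite partial map from addresses $(\ell,f)$ to $\mathsf{Loc}$, undefined on all $(\mathsf{nil},f)$; $\mathrm{loc}(h)$ is the set of $\ell$ with some $(\ell,f)\in\mathrm{dom}\,h$. In a frame $s$ and heap $h$, $x.f$ has the address $(s(x),f)$, $\pi.f$ has the address $(h(a),f)$ with $a$ the address of $\pi$, and a path has the value of $h$ at its address. For a non-empty call stack $S$, $[\![C]\!]\langle S,h,L\rangle$ is the set of traces of complete executions of $C$, a trace being the list of executed commands, each paired with the resulting call stack, heap and lock count. $\mathtt{skip}$ yields the empty trace; a load or store through a path needs its address to lie in $\mathrm{dom}\,h$ (otherwise there is no trace); $\mathtt{new}$ allocates any non-nil $\ell\notin\mathrm{loc}(h)$, setting all its fields to $\ell$; $\mathtt{lock}()$ increments the lock count, and $\mathtt{unlock}()$ decrements it if it is positive (otherwise there is no trace). Branches and the number of loop iterations are chosen non-deterministically. A call evaluates its arguments, records $\mathtt{push}(e_1,\dots,e_n)$ with a new frame holding the arguments in the formals and $\mathsf{nil}$ elsewhere,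 runs the body, and records $\mathtt{pop}$, which removes the frame. $(S,h)$ is *well-behaved* if every variable of every frame of $S$ and every cell of $h$ holds an element of $\mathrm{loc}(h)$, and $(\ell,f)\in\mathrm{dom}\,h$ for all $\ell\in\mathrm{loc}(h)$ and all fields $f$. *Analysis.* Fix $\hat L\in\mathbb N$; put $L\mathbin{\hat+}L'=\min(L+L',\hat L)$. Abstract states are triples $\langle W,L,A\rangle$ with $W$ a set of expressions, $L\in\mathbb N$, and $A$ a set of pairs $\langle c,L\rangle$, $c$ of the form $x:=\pi$ or $\pi:=x$; $\bot=\langle\emptyset,0,\emptyset\rangle$ and $\sqcup$ is $(\cup,\max,\cup)$. Write $E^{\mathsf{fml}}$ for the elements of $E$ whose expression (for accesses: whose path) is rooted at a formal. The abstract semantics $[\![\cdot]\!]^\sharp$ is: - a simple $c$ adds to $W$ the set $\{x,e\}^{\mathsf{fml}}$ if $c$ is $x:=e$ or $e:=x$, and $\{x\}^{\mathsf{fml}}$ if $c$ is $x:=\mathtt{new}()$; it replaces $L$ by $L\mathbin{\hat+}1$ for $\mathtt{lock}()$, by $\max(L-1,0)$ for $\mathtt{unlock}()$; it adds $\{\langle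 c,L\rangle\}^{\mathsf{fml}}$ to $A$ if $c$ is $x:=\pi$ or $\pi:=x$; - sequencing composes; $C;\mathtt{if}(*)\,C_1\,C_2$ maps $D$ to $[\![C_1]\!]^\sharp D'\sqcup[\![C_2]\!]^\sharp D'$ and $C;\mathtt{while}(*)\,C'$ maps $D$ to $D'\sqcup[\![C']\!]^\sharp D'$, where $D'=[\![C]\!]^\sharp D$; - a call $\mathsf m(e_1,\dots,e_n)$ maps $\langle W,L,A\rangle$ to $\langle W\cup\{e_i\mid\exists j\ne i.\ e_i\preccurlyeq e_j\}^{\mathsf{fml}}\cup(W'[\vec e/\vec{\mathtt{arg}}])^{\mathsf{fml}},\ L\mathbin{\hat+}L',\ A\cup(\{\langle c,L\mathbin{\hat+}L_c\rangle\mid\langle c,L_c\rangle\in A'\}[\vec e/\vec{\mathtt{arg}}])^{\mathsf{fml}}\rangle$, where $\langle W',L',A'\rangle$ is the abstract semantics of the body of $\mathsf m$ applied to $\bot$, and substitution in an access acts on its path only. *Abstraction.* The abstract state of a trace is obtained by folding its commands from left to right, starting from $\bot$ and the empty stack $\bar\theta$ of substitutions. Simple commands act as above, except that instead of filtering by $\mathsf{fml}$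 each expression (or path of an access) is resolved through $\bar\theta$: substitutions are applied successively from the innermost to the outermost, the expression being dropped if its root is outside the domain of the substitution to be applied, or if finally it is not rooted at a formal. $\mathtt{push}(e_1,\dots,e_n)$ adds to $W$ the resolved elements of $\{e_i\mid\exists j\neq i.\ e_i\preccurlyeq e_j\}$ and pushes $[\mathtt{arg}_i\mapsto e_i]_{i=1}^n$ on $\bar\theta$; $\mathtt{pop}$ removes the top of $\bar\theta$. For a set $T$ of traces, $\alpha(T)$ is the join of the abstract states of all traces in $T$. **Theorem.** Let $C$ be a compound program with balanced locking whose methods are all in Argument-Normal Form, let $(S,h)$ be well-behaved, and suppose that the lock count never exceeds $\hat L$ in the traces of $[\![C]\!]\langle S,h,0\rangle$. Then $$[\![C]\!]^\sharp\bot=\alpha\big([\![C]\!]\langle S,h,0\rangle\big).$$ -/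

import Mathlib

/-! An idealized object language with one class, one reentrant lock and non-recursive methods:
syntax, static conventions, trace-collecting semantics, path/lock analysis and abstraction. -/

namespace RacerDX

/-! ### Syntax -/

/-- Variables: the formal parameters `arg 0, arg 1, …` (numbered from `0`) and the locals. -/
inductive Var where
  | arg (i : ℕ)
  | loc (k : ℕ)

/-- Being of the form `argᵢ`. -/
def Var.IsFormal (x : Var) : Prop := ∃ i, x = Var.arg i

/-- Access paths `x.f` and `π.f`. -/
inductive Path (F : Type*) where
  | base (x : Var) (f : F)
  | dot (π : Path F) (f : F)

/-- Expressions: variables and paths. -/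
inductive Exp (F : Type*) where
  | var (x : Var)
  | path (π : Path F)

/-- Simple statements that may be used in programs. -/
inductive Stmt (F : Type*) where
  | skip
  | move (x y : Var)
  | load (x : Var) (π : Path F)
  | store (π : Path F) (x : Var)
  | new (x : Var)
  | lock
  | unlock

/-- Compound statements over the method names `M`. -/
inductive CStmt (F M : Type*) where
  | simple (c : Stmt F)
  | seq (C : CStmt F M) (c : Stmt F)
  | ite (C C₁ C₂ : CStmt F M)
  | loop (C C' : CStmt F M)
  | call (C : CStmt F M) (m : M) (es : List (Exp F))

/-- The methods of the class. -/
structure Methods (F M : Type*) where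
  body : M → CStmt F M
  arity : M → ℕ

section Syntactic
variable {F M : Type*}

def Path.root : Path F → Var
  | .base x _ => x
  | .dot π _ => π.root

def Exp.root : Exp F → Var
  | .var x => x
  | .path π => π.root

/-- The path `e.f`. -/
def Exp.dot : Exp F → F → Path F
  | .var x, f => .base x f
  | .path π, f => .dot π f

/-- The (non-strict) prefix order `e ≼ e'` on expressions. -/
inductive Exp.Prefix : Exp F → Exp F → Prop
  | refl (e : Exp F) : Exp.Prefix e e
  | step {e e' : Exp F} (f : F) : Exp.Prefix e e' → Exp.Prefix e (.path (e'.dot f))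

/-- A substitution `[argᵢ ↦ eᵢ]` is given by the list of the `eᵢ`; its domain consists of the
`argᵢ` with `i` smaller than the length of the list. -/
def Var.InDom (θ : List (Exp F)) (x : Var) : Prop := ∃ i, x = Var.arg i ∧ i < θ.length

/-- Substitution in a variable; variables outside the domain are left alone. -/
def Var.subst (θ : List (Exp F)) : Var → Exp F
  | .arg i => θ.getD i (.var (.arg i))
  | .loc k => .var (.loc k)

def Path.subst (θ : List (Exp F)) : Path F → Path F
  | .base x f => (x.subst θ).dot f
  | .dot π f => .dot (π.subst θ) f

def Exp.subst (θ : List (Exp F)) : Exp F → Exp F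
  | .var x => x.subst θ
  | .path π => .path (π.subst θ)

/-- Arguments `eᵢ` that are a prefix of some argument `eⱼ` with `j ≠ i`. -/
def aliased (es : List (Exp F)) : Set (Exp F) :=
  {e | ∃ (i j : ℕ) (e' : Exp F), i ≠ j ∧ es[i]? = some e ∧ es[j]? = some e' ∧ e.Prefix e'}

/-! ### Static conventions -/

/-- The variables occurring in a simple statement. -/
def Stmt.vars : Stmt F → Set Var
  | .move x y => {x, y}
  | .load x π => {x, π.root}
  | .store π x => {π.root, x}
  | .new x => {x}
  | .skip | .lock | .unlock => ∅

/-- The variables occurring in a compound statement. -/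
def CStmt.vars : CStmt F M → Set Var
  | .simple c => c.vars
  | .seq C c => C.vars ∪ c.vars
  | .ite C C₁ C₂ => C.vars ∪ C₁.vars ∪ C₂.vars
  | .loop C C' => C.vars ∪ C'.vars
  | .call C _ es => C.vars ∪ {x | ∃ e ∈ es, e.root = x}

/-- The methods called directly from a compound statement. -/
def CStmt.callees : CStmt F M → Set M
  | .simple _ => ∅
  | .seq C _ => C.callees
  | .ite C C₁ C₂ => C.callees ∪ C₁.callees ∪ C₂.callees
  | .loop C C' => C.callees ∪ C'.callees
  | .call C m _ => C.callees ∪ {m}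

/-- Every call passes as many arguments as the method has formals. -/
def CStmt.ArityOK (P : Methods F M) : CStmt F M → Prop
  | .simple _ => True
  | .seq C _ => C.ArityOK P
  | .ite C C₁ C₂ => C.ArityOK P ∧ C₁.ArityOK P ∧ C₂.ArityOK P
  | .loop C C' => C.ArityOK P ∧ C'.ArityOK P
  | .call C m es => C.ArityOK P ∧ es.length = P.arity m

/-- The variables that a simple statement reads. -/
def Stmt.uses : Stmt F → Set Var
  | .move _ y => {y}
  | .load _ π => {π.root}
  | .store π x => {π.root, x}
  | .skip | .new _ | .lock | .unlock => ∅

/-- The variables that a simple statement assigns. -/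
def Stmt.assigns : Stmt F → Set Var
  | .move x _ | .load x _ | .new x => {x}
  | .skip | .store _ _ | .lock | .unlock => ∅

/-- The variables definitely assigned after `C`, when those in `X` were before. -/
def CStmt.assigned : CStmt F M → Set Var → Set Var
  | .simple c, X => X ∪ c.assigns
  | .seq C c, X => C.assigned X ∪ c.assigns
  | .ite C C₁ C₂, X => C₁.assigned (C.assigned X) ∩ C₂.assigned (C.assigned X)
  | .loop C _, X => C.assigned X
  | .call C _ _, X => C.assigned X

/-- Definite assignment: started with the variables in `X` assigned, `C` never uses a variable
that has not been assigned before on every control path. -/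
def CStmt.DefAssign : CStmt F M → Set Var → Prop
  | .simple c, X => c.uses ⊆ X
  | .seq C c, X => C.DefAssign X ∧ c.uses ⊆ C.assigned X
  | .ite C C₁ C₂, X =>
      C.DefAssign X ∧ C₁.DefAssign (C.assigned X) ∧ C₂.DefAssign (C.assigned X)
  | .loop C C', X => C.DefAssign X ∧ C'.DefAssign (C.assigned X)
  | .call C _ es, X => C.DefAssign X ∧ ∀ e ∈ es, e.root ∈ C.assigned X

/-- The formals of a method with `n` parameters. -/
def formals (n : ℕ) : Set Var := {x | ∃ i < n, x = Var.arg i}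

/-- The conventions on method bodies: no formal beyond the arity occurs, calls respect arities,
and local variables are assigned before use. -/
def Methods.WellFormed (P : Methods F M) : Prop :=
  ∀ m, (∀ i, Var.arg i ∈ (P.body m).vars → i < P.arity m) ∧ (P.body m).ArityOK P ∧
    (P.body m).DefAssign (formals (P.arity m))

/-- No recursion: there is no infinite chain of methods each calling the next one. -/
def Methods.NonRecursive (P : Methods F M) : Prop :=
  WellFounded fun m' m => m' ∈ (P.body m).callees

/-- Every simple statement of `C` satisfies `p`. -/
def CStmt.AllSimple (p : Stmt F → Prop) : CStmt F M → Prop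
  | .simple c => p c
  | .seq C c => C.AllSimple p ∧ p c
  | .ite C C₁ C₂ => C.AllSimple p ∧ C₁.AllSimple p ∧ C₂.AllSimple p
  | .loop C C' => C.AllSimple p ∧ C'.AllSimple p
  | .call C _ _ => C.AllSimple p

/-- Argument-Normal Form of all methods: no body contains a statement `π := argⱼ`. -/
def Methods.ANF (P : Methods F M) : Prop :=
  ∀ m, (P.body m).AllSimple fun c => ∀ π j, c ≠ .store π (.arg j)

/-- The number of pending `lock()`s after a simple statement when there were `n` before;
`none` for an `unlock()` that has no matching `lock()`. -/
def Stmt.pending : Stmt F → ℕ → Option ℕ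
  | .lock, n => some (n + 1)
  | .unlock, 0 => none
  | .unlock, n + 1 => some n
  | _, n => some n

open Classical in
/-- The number of pending `lock()`s after `C` when there were `n` before; `none` if some
`unlock()` has no matching `lock()`, or some branch or loop body is not balanced by itself.
(Calls contribute nothing, as method bodies are required to be balanced.) -/
noncomputable def CStmt.pending : CStmt F M → ℕ → Option ℕ
  | .simple c, n => c.pending n
  | .seq C c, n => (C.pending n).bind c.pending
  | .ite C C₁ C₂, n => if C₁.pending 0 = some 0 ∧ C₂.pending 0 = some 0 then C.pending n else none
  | .loop C C', n => if C'.pending 0 = some 0 then C.pending n else none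
  | .call C _ _, n => C.pending n

/-- Balanced locking: `lock()` and `unlock()` come in balanced pairs within method bodies, branches
and loop bodies, and every `unlock()` of `C` has a matching `lock()`. -/
def BalancedLocking (P : Methods F M) (C : CStmt F M) : Prop :=
  (∃ k, C.pending 0 = some k) ∧ ∀ m, (P.body m).pending 0 = some 0

end Syntactic

/-! ### States -/

/-- The countably infinite set of locations. -/
abbrev Loc := ℕ

/-- The location that is never allocated. -/
def nil : Loc := 0

/-- Stacks (stores): maps from variables to locations. -/
abbrev Store := Var → Loc

/-- Heaps: finite partial maps from addresses to locations, undefined at every `(nil, f)`. -/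
structure Heap (F : Type*) where
  map : Loc × F → Option Loc
  finite_dom : {a | map a ≠ none}.Finite
  nil_free : ∀ f, map (nil, f) = none

section States
variable {F M : Type*}

def Heap.dom (h : Heap F) : Set (Loc × F) := {a | h.map a ≠ none}

/-- The allocated locations of a heap. -/
def Heap.locs (h : Heap F) : Set Loc := Prod.fst '' h.dom

open Classical in
/-- `h[a ↦ ℓ]`, for `a` in the domain of `h`. -/
noncomputable def Heap.write (h : Heap F) (a : Loc × F) (ha : a ∈ h.dom) (ℓ : Loc) : Heap F where
  map := Function.update h.map a (some ℓ)
  finite_dom := h.finite_dom.subset fun b hb => by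
    by_cases hab : b = a
    · subst hab; exact ha
    · simpa [Function.update_of_ne hab] using hb
  nil_free f := by
    have hne : (nil, f) ≠ a := fun e => ha (e ▸ h.nil_free f)
    rw [Function.update_of_ne hne]
    exact h.nil_free f

open Classical in
/-- `h ∪ {(ℓ, f) ↦ ℓ | f a field}`. -/
noncomputable def Heap.alloc [Finite F] (h : Heap F) (ℓ : Loc) (hℓ : ℓ ≠ nil) : Heap F where
  map a := if a.1 = ℓ then some ℓ else h.map a
  finite_dom := by
    refine (h.finite_dom.union (Set.finite_range fun f : F => (ℓ, f))).subset ?_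
    rintro ⟨l, f⟩ hb
    by_cases hl : l = ℓ
    · right; exact ⟨f, by simp [hl]⟩
    · left; simpa [hl] using hb
  nil_free f := by simp [Ne.symm hℓ, h.nil_free f]

/-- The address of a path. -/
def Path.lval (s : Store) (h : Heap F) : Path F → Option (Loc × F)
  | .base x f => some (s x, f)
  | .dot π f => ((π.lval s h).bind h.map).map fun ℓ => (ℓ, f)

/-- The value of an expression. -/
def Exp.eval (s : Store) (h : Heap F) : Exp F → Option Loc
  | .var x => some (s x)
  | .path π => (π.lval s h).bind h.map

/-- `⟨s :: S, h, L⟩`: the current stack frame, the other frames, the heap, the lock context. -/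
structure Config (F : Type*) where
  frame : Store
  frames : List Store
  heap : Heap F
  locks : ℕ

/-- Well-behaved stack/heap: all variables and all heap cells hold allocated locations, and an
allocated object has all the fields of the class. -/
def WellBehaved (S : List Store) (h : Heap F) : Prop :=
  (∀ s ∈ S, ∀ x, s x ∈ h.locs) ∧ (∀ a ℓ, h.map a = some ℓ → ℓ ∈ h.locs) ∧
    ∀ ℓ ∈ h.locs, ∀ f, (ℓ, f) ∈ h.dom

/-! ### Trace-collecting semantics -/

/-- The commands recorded in traces: simple statements, and the run-time `push` and `pop`. -/
inductive Label (F : Type*) where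
  | stmt (c : Stmt F)
  | push (es : List (Exp F))
  | pop

/-- Execution traces: each entry is a command and the configuration it produced. -/
abbrev Trace (F : Type*) := List (Label F × Config F)

/-- The configuration at the end of a trace that starts from `κ`. -/
def Trace.final (τ : Trace F) (κ : Config F) : Config F :=
  (τ.getLast?.map Prod.snd).getD κ

open Classical in
noncomputable def Store.set (s : Store) (x : Var) (ℓ : Loc) : Store := Function.update s x ℓ

/-- The traces of a simple statement. -/
def Stmt.traces [Finite F] (c : Stmt F) (κ : Config F) : Set (Trace F) :=
  match c with
  | .skip => {[]}
  | .move x y => {[(.stmt (.move x y), { κ with frame := Store.set κ.frame x (κ.frame y) })]}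
  | .load x π => {τ | ∃ a ℓ, π.lval κ.frame κ.heap = some a ∧ κ.heap.map a = some ℓ ∧
      τ = [(.stmt (.load x π), { κ with frame := Store.set κ.frame x ℓ })]}
  | .store π x => {τ | ∃ a, π.lval κ.frame κ.heap = some a ∧ ∃ ha : a ∈ κ.heap.dom,
      τ = [(.stmt (.store π x), { κ with heap := κ.heap.write a ha (κ.frame x) })]}
  | .new x => {τ | ∃ ℓ, ℓ ∉ κ.heap.locs ∧ ∃ hℓ : ℓ ≠ nil,
      τ = [(.stmt (.new x),
        { κ with frame := Store.set κ.frame x ℓ, heap := κ.heap.alloc ℓ hℓ })]}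
  | .lock => {[(.stmt .lock, { κ with locks := κ.locks + 1 })]}
  | .unlock => {τ | 0 < κ.locks ∧ τ = [(.stmt .unlock, { κ with locks := κ.locks - 1 })]}

/-- The initial frame of a callee: the formals hold the arguments, all else is `nil`. -/
def calleeFrame (vs : List Loc) : Store
  | .arg i => vs.getD i nil
  | .loc _ => nil

/-- `Run P C κ τ`: `τ` is a trace of the complete execution of `C` from `κ`. -/
inductive Run [Finite F] (P : Methods F M) : CStmt F M → Config F → Trace F → Prop
  | simple {c κ τ} : τ ∈ Stmt.traces c κ → Run P (.simple c) κ τ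
  | seq {C c κ τ τ'} : Run P C κ τ → τ' ∈ Stmt.traces c (τ.final κ) →
      Run P (.seq C c) κ (τ ++ τ')
  | ite_left {C C₁ C₂ κ τ τ'} : Run P C κ τ → Run P C₁ (τ.final κ) τ' →
      Run P (.ite C C₁ C₂) κ (τ ++ τ')
  | ite_right {C C₁ C₂ κ τ τ'} : Run P C κ τ → Run P C₂ (τ.final κ) τ' →
      Run P (.ite C C₁ C₂) κ (τ ++ τ')
  | loop_exit {C C' κ τ} : Run P C κ τ → Run P (.loop C C') κ τ
  | loop_iter {C C' κ τ τ'} : Run P (.loop C C') κ τ → Run P C' (τ.final κ) τ' →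
      Run P (.loop C C') κ (τ ++ τ')
  | call {C m es κ τ vs κ₀ τ' s' S'} : Run P C κ τ →
      List.Forall₂ (fun e v => Exp.eval (τ.final κ).frame (τ.final κ).heap e = some v) es vs →
      κ₀ = { τ.final κ with
              frame := calleeFrame vs, frames := (τ.final κ).frame :: (τ.final κ).frames } →
      Run P (P.body m) κ₀ τ' →
      (τ'.final κ₀).frames = s' :: S' →
      Run P (.call C m es) κ (τ ++ [(.push es, κ₀)] ++ τ' ++
        [(.pop, { τ'.final κ₀ with frame := s', frames := S' })])

/-- The trace-collecting semantics of `C`. -/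
def traces [Finite F] (P : Methods F M) (C : CStmt F M) (κ : Config F) : Set (Trace F) :=
  {τ | Run P C κ τ}

end States

/-! ### The analysis -/

/-- Reads `x := π` and writes `π := x`. -/
inductive Access (F : Type*) where
  | read (x : Var) (π : Path F)
  | write (π : Path F) (x : Var)

/-- Abstract states `⟨W, L, A⟩`: wobbly expressions, lock context, recorded accesses. -/
@[ext] structure AbsState (F : Type*) where
  W : Set (Exp F)
  L : ℕ
  A : Set (Access F × ℕ)

section Analysis
variable {F M : Type*}

def Access.path : Access F → Path F
  | .read _ π => π
  | .write π _ => π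

/-- Substitution acts on the path component of an access only. -/
def Access.subst (θ : List (Exp F)) : Access F → Access F
  | .read x π => .read x (π.subst θ)
  | .write π x => .write (π.subst θ) x

def AbsState.bot : AbsState F := ⟨∅, 0, ∅⟩

def AbsState.join (D₁ D₂ : AbsState F) : AbsState F :=
  ⟨D₁.W ∪ D₂.W, max D₁.L D₂.L, D₁.A ∪ D₂.A⟩

/-- The expressions of a set that are rooted at formals. -/
def fml (E : Set (Exp F)) : Set (Exp F) := {e | e ∈ E ∧ e.root.IsFormal}

/-- The recorded accesses of a set whose path is rooted at a formal. -/
def fmlA (A : Set (Access F × ℕ)) : Set (Access F × ℕ) := {q | q ∈ A ∧ q.1.path.root.IsFormal}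

/-- Addition of lock contexts, cut off at `Lhat`. -/
def addLock (Lhat L L' : ℕ) : ℕ := min (L + L') Lhat

/-- The expressions that a simple statement makes wobbly. -/
def Stmt.wobbly : Stmt F → Set (Exp F)
  | .move x y => {.var x, .var y}
  | .load x π => {.var x, .path π}
  | .store π x => {.var x, .path π}
  | .new x => {.var x}
  | .skip | .lock | .unlock => ∅

/-- The change of the lock context by a simple statement. -/
def Stmt.locking (Lhat : ℕ) : Stmt F → ℕ → ℕ
  | .lock, L => addLock Lhat L 1
  | .unlock, L => max (L - 1) 0
  | _, L => L

/-- The accesses made by a simple statement in lock context `L`. -/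
def Stmt.accesses : Stmt F → ℕ → Set (Access F × ℕ)
  | .load x π, L => {(.read x π, L)}
  | .store π x, L => {(.write π x, L)}
  | _, _ => ∅

/-- The abstract semantics of a simple statement. -/
def Stmt.analyze (Lhat : ℕ) (c : Stmt F) (D : AbsState F) : AbsState F :=
  ⟨D.W ∪ fml c.wobbly, c.locking Lhat D.L, D.A ∪ fmlA (c.accesses D.L)⟩

/-- The abstract semantics of a call with arguments `es` of a method with summary `D'`:
the summary is instantiated, and what is rooted at a local of the caller is discarded. -/
def applySummary (Lhat : ℕ) (es : List (Exp F)) (D' D : AbsState F) : AbsState F :=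
  ⟨D.W ∪ fml (aliased es) ∪ fml (Exp.subst es '' D'.W),
    addLock Lhat D.L D'.L,
    D.A ∪ fmlA ((fun q => (q.1.subst es, addLock Lhat D.L q.2)) '' D'.A)⟩

/-- The abstract semantics of a compound statement, given summaries of the methods. -/
def CStmt.analyzeWith (Lhat : ℕ) (sm : M → AbsState F) : CStmt F M → AbsState F → AbsState F
  | .simple c, D => c.analyze Lhat D
  | .seq C c, D => c.analyze Lhat (C.analyzeWith Lhat sm D)
  | .ite C C₁ C₂, D =>
      (C₁.analyzeWith Lhat sm (C.analyzeWith Lhat sm D)).join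
        (C₂.analyzeWith Lhat sm (C.analyzeWith Lhat sm D))
  | .loop C C', D =>
      (C.analyzeWith Lhat sm D).join (C'.analyzeWith Lhat sm (C.analyzeWith Lhat sm D))
  | .call C m es, D => applySummary Lhat es (sm m) (C.analyzeWith Lhat sm D)

open Classical in
/-- The summary of a method: the analysis of its body from the bottom element, by recursion along
the call relation. -/
noncomputable def summary (P : Methods F M) (hP : P.NonRecursive) (Lhat : ℕ) : M → AbsState F :=
  hP.fix fun m rec =>
    (P.body m).analyzeWith Lhat
      (fun m' => if hm : m' ∈ (P.body m).callees then rec m' hm else AbsState.bot) AbsState.bot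

/-- The abstract semantics of a compound statement. -/
noncomputable def analyze (P : Methods F M) (hP : P.NonRecursive) (Lhat : ℕ) (C : CStmt F M)
    (D : AbsState F) : AbsState F :=
  C.analyzeWith Lhat (summary P hP Lhat) D

theorem CStmt.analyzeWith_congr (Lhat : ℕ) {sm sm' : M → AbsState F} (C : CStmt F M)
    (H : ∀ m ∈ C.callees, sm m = sm' m) (D : AbsState F) :
    C.analyzeWith Lhat sm D = C.analyzeWith Lhat sm' D := by
  induction C generalizing D with
  | simple c => rfl
  | seq C c ih => simp only [analyzeWith, ih H]
  | ite C C₁ C₂ ih ih₁ ih₂ =>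
    simp only [analyzeWith, ih fun m hm => H m (Or.inl (Or.inl hm)),
      ih₁ fun m hm => H m (Or.inl (Or.inr hm)), ih₂ fun m hm => H m (Or.inr hm)]
  | loop C C' ih ih' =>
    simp only [analyzeWith, ih fun m hm => H m (Or.inl hm), ih' fun m hm => H m (Or.inr hm)]
  | call C m es ih =>
    simp only [analyzeWith, ih fun m hm => H m (Or.inl hm), H m (Or.inr rfl)]

/-- The defining equation of summaries. -/
theorem summary_eq (P : Methods F M) (hP : P.NonRecursive) (Lhat : ℕ) (m : M) :
    summary P hP Lhat m = analyze P hP Lhat (P.body m) AbsState.bot := by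
  refine (WellFounded.fix_eq hP _ m).trans ?_
  refine CStmt.analyzeWith_congr _ _ (fun m' hm' => ?_) _
  rw [dif_pos hm']
  rfl

/-! ### The abstraction of traces -/

open Classical in
/-- A path of the current frame expressed in terms of the outermost frame, through a stack of
substitutions; `none` if its root is local to some frame. -/
noncomputable def Path.resolve : List (List (Exp F)) → Path F → Option (Path F)
  | [], π => if π.root.IsFormal then some π else none
  | θ :: Θ, π => if π.root.InDom θ then Path.resolve Θ (π.subst θ) else none

open Classical in
/-- The same for expressions. -/
noncomputable def Exp.resolve : List (List (Exp F)) → Exp F → Option (Exp F)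
  | [], e => if e.root.IsFormal then some e else none
  | θ :: Θ, e => if e.root.InDom θ then Exp.resolve Θ (e.subst θ) else none

/-- The same for accesses, acting on the path component. -/
noncomputable def Access.resolve (Θ : List (List (Exp F))) : Access F → Option (Access F)
  | .read x π => (π.resolve Θ).map fun π' => .read x π'
  | .write π x => (π.resolve Θ).map fun π' => .write π' x

def resolveSet (Θ : List (List (Exp F))) (E : Set (Exp F)) : Set (Exp F) :=
  {e' | ∃ e ∈ E, e.resolve Θ = some e'}

def resolveSetA (Θ : List (List (Exp F))) (A : Set (Access F × ℕ)) : Set (Access F × ℕ) :=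
  {q | ∃ a, (a, q.2) ∈ A ∧ a.resolve Θ = some q.1}

/-- The effect of one recorded command on an abstract state and a stack of substitutions. -/
def execStep (Lhat : ℕ) (X : AbsState F × List (List (Exp F))) :
    Label F → AbsState F × List (List (Exp F))
  | .stmt c =>
      (⟨X.1.W ∪ resolveSet X.2 c.wobbly, c.locking Lhat X.1.L,
        X.1.A ∪ resolveSetA X.2 (c.accesses X.1.L)⟩, X.2)
  | .push es => (⟨X.1.W ∪ resolveSet X.2 (aliased es), X.1.L, X.1.A⟩, es :: X.2)
  | .pop => (X.1, X.2.tail)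

/-- Left-to-right execution of a syntactic trace. -/
def exec (Lhat : ℕ) (t : List (Label F)) (X : AbsState F × List (List (Exp F))) :
    AbsState F × List (List (Exp F)) :=
  t.foldl (execStep Lhat) X

/-- The abstract state of a single trace, computed from its commands only. -/
def Trace.abs (Lhat : ℕ) (τ : Trace F) : AbsState F :=
  (exec Lhat (τ.map Prod.fst) (AbsState.bot, [])).1

/-- The abstraction `α`: the join over all traces. (The lock contexts are bounded by `Lhat`, so that
their supremum in `ℕ` is a genuine one.) -/
noncomputable def abstraction (Lhat : ℕ) (T : Set (Trace F)) : AbsState F :=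
  ⟨⋃ τ ∈ T, (τ.abs Lhat).W, sSup ((fun τ => (τ.abs Lhat).L) '' T), ⋃ τ ∈ T, (τ.abs Lhat).A⟩

end Analysis

end RacerDX

namespace RacerDX

/-! ### Syntactic runs -/

section
variable {F M : Type*}

/-! The abstract effect of a command depends only on the commands executed before it, never on stack
or heap. Hence both sides of the equation can be compared with a third object, the facts (wobbly
expressions and accesses) contributed by the control paths of `C`, described without states by
`Unfolds` and `Steps`.

The analysis computes exactly these facts (`CStmt.analyzeWith_exact`). Joins lose nothing, because a
fact comes from a single command and every partial path extends to a complete one. One pass through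
a loop body suffices, because balanced bodies restore the lock count and a later iteration
contributes the same facts. Summaries are exact, because running a body under a stack of
substitutions and with locks already held merely resolves its facts further and shifts their lock
contexts (`Steps.instantiate`). `Steps` counts locks without a cut-off; the bound `Lhat` on the
traces makes the cut-off of the analysis inactive.

The control paths are exactly the command lists of concrete traces. Every trace yields a path
(`Run.unfolds`); conversely every path can be executed (`Unfolds.exists_run`). Allocated objects
have all fields and cells hold allocated locations, so no dereference fails; definite assignment
does the same for the locals of callees, and balanced locking for `unlock`. -/

/-- The labels recorded for a simple statement. -/
def Stmt.labels : Stmt F → List (Label F)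
  | .skip => []
  | c => [.stmt c]

/-- `Unfolds P C t`: `t` is the list of labels along some control path through `C`, regardless of
any state. -/
inductive Unfolds (P : Methods F M) : CStmt F M → List (Label F) → Prop
  | simple (c) : Unfolds P (.simple c) c.labels
  | seq {C t} (c) : Unfolds P C t → Unfolds P (.seq C c) (t ++ c.labels)
  | ite_left {C C₁ C₂ t t'} : Unfolds P C t → Unfolds P C₁ t' → Unfolds P (.ite C C₁ C₂) (t ++ t')
  | ite_right {C C₁ C₂ t t'} : Unfolds P C t → Unfolds P C₂ t' →
      Unfolds P (.ite C C₁ C₂) (t ++ t')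
  | loop_exit {C C' t} : Unfolds P C t → Unfolds P (.loop C C') t
  | loop_iter {C C' t t'} : Unfolds P (.loop C C') t → Unfolds P C' t' →
      Unfolds P (.loop C C') (t ++ t')
  | call {C m t t'} (es) : Unfolds P C t → Unfolds P (P.body m) t' →
      Unfolds P (.call C m es) (t ++ (.push es :: (t' ++ [.pop])))

theorem exists_unfolds_of_callees {P : Methods F M} (C : CStmt F M)
    (H : ∀ m ∈ C.callees, ∃ t, Unfolds P (P.body m) t) : ∃ t, Unfolds P C t := by
  induction C with
  | simple c => exact ⟨_, .simple c⟩
  | seq C c ih =>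
    obtain ⟨t, ht⟩ := ih H
    exact ⟨_, .seq c ht⟩
  | ite C C₁ C₂ ih ih₁ _ =>
    obtain ⟨t, ht⟩ := ih fun m hm => H m (Or.inl (Or.inl hm))
    obtain ⟨t₁, ht₁⟩ := ih₁ fun m hm => H m (Or.inl (Or.inr hm))
    exact ⟨_, .ite_left ht ht₁⟩
  | loop C C' ih _ =>
    obtain ⟨t, ht⟩ := ih fun m hm => H m (Or.inl hm)
    exact ⟨_, .loop_exit ht⟩
  | call C m es ih =>
    obtain ⟨t, ht⟩ := ih fun m hm => H m (Or.inl hm)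
    obtain ⟨t', ht'⟩ := H m (Or.inr rfl)
    exact ⟨_, .call es ht ht'⟩

/-- Non-recursion enters here: a fact found in one part of a statement can be attributed to the
whole only if the other parts have some complete path. -/
theorem Methods.NonRecursive.exists_unfolds {P : Methods F M} (hP : P.NonRecursive)
    (C : CStmt F M) : ∃ t, Unfolds P C t :=
  exists_unfolds_of_callees C fun m _ =>
    hP.induction (C := fun m => ∃ t, Unfolds P (P.body m) t) m fun _ ih =>
      exists_unfolds_of_callees _ ih

/-! ### Lock counts -/

theorem Stmt.pending_add {c : Stmt F} {n k : ℕ} (h : c.pending n = some k) (j : ℕ) :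
    c.pending (n + j) = some (k + j) := by
  cases c <;> cases n <;> simp_all [Stmt.pending, Nat.add_right_comm]
  all_goals omega

/-- The balance conditions on branches and loop bodies are always tested from `0`, so they do not
see `j`. -/
theorem CStmt.pending_add {C : CStmt F M} {n k : ℕ} (h : C.pending n = some k) (j : ℕ) :
    C.pending (n + j) = some (k + j) := by
  induction C generalizing n k with
  | simple c => exact Stmt.pending_add h j
  | seq C c ih =>
    simp only [pending, Option.bind_eq_some_iff] at h ⊢
    obtain ⟨i, hi, hc⟩ := h
    exact ⟨_, ih hi, Stmt.pending_add hc j⟩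
  | ite C C₁ C₂ ih =>
    simp only [pending] at h ⊢
    split_ifs at h ⊢ with hb
    exact ih h
  | loop C C' ih =>
    simp only [pending] at h ⊢
    split_ifs at h ⊢ with hb
    exact ih h
  | call C m es ih => exact ih h

theorem CStmt.pending_self {C : CStmt F M} (h : C.pending 0 = some 0) (n : ℕ) :
    C.pending n = some n := by
  simpa using pending_add h n

theorem CStmt.pending_ite {C C₁ C₂ : CStmt F M} {n k : ℕ}
    (h : (CStmt.ite C C₁ C₂).pending n = some k) :
    C.pending n = some k ∧ C₁.pending 0 = some 0 ∧ C₂.pending 0 = some 0 := by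
  simp only [pending] at h
  split_ifs at h with hb
  exact ⟨h, hb⟩

theorem CStmt.pending_loop {C C' : CStmt F M} {n k : ℕ}
    (h : (CStmt.loop C C').pending n = some k) :
    C.pending n = some k ∧ C'.pending 0 = some 0 := by
  simp only [pending] at h
  split_ifs at h with hb
  exact ⟨h, hb⟩

/-- The lock count after a command. -/
def Label.locksAfter : Label F → ℕ → ℕ
  | .stmt .lock, n => n + 1
  | .stmt .unlock, n => n - 1
  | _, n => n

theorem Label.locksAfter_mono (l : Label F) : Monotone l.locksAfter := by
  intro m n h
  rcases l with (_ | _ | _ | _ | _ | _ | _) | _ | _ <;> simp only [locksAfter] <;> omega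

/-- Along the commands of a list the lock count never exceeds `Lhat`. -/
def Bounded (Lhat : ℕ) : List (Label F) → ℕ → Prop
  | [], n => n ≤ Lhat
  | l :: t, n => n ≤ Lhat ∧ Bounded Lhat t (l.locksAfter n)

def locksAfter (t : List (Label F)) (n : ℕ) : ℕ := t.foldl (fun n l => l.locksAfter n) n

theorem locksAfter_append (t t' : List (Label F)) (n : ℕ) :
    locksAfter (t ++ t') n = locksAfter t' (locksAfter t n) := List.foldl_append

theorem Bounded.head_le {Lhat : ℕ} {t : List (Label F)} {n : ℕ} (h : Bounded Lhat t n) :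
    n ≤ Lhat := by
  cases t
  exacts [h, h.1]

theorem bounded_append {Lhat : ℕ} {t t' : List (Label F)} {n : ℕ} :
    Bounded Lhat (t ++ t') n ↔ Bounded Lhat t n ∧ Bounded Lhat t' (locksAfter t n) := by
  induction t generalizing n with
  | nil => exact ⟨fun h => ⟨h.head_le, h⟩, And.right⟩
  | cons l t ih => simp only [List.cons_append, Bounded, ih, and_assoc]; rfl

/-- A method body that fits in the lock context of a call site also fits from `0`, where its summary
is computed. -/
theorem Bounded.anti {Lhat : ℕ} {t : List (Label F)} {m n : ℕ} (hmn : m ≤ n)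
    (h : Bounded Lhat t n) : Bounded Lhat t m := by
  induction t generalizing m n with
  | nil => exact hmn.trans h
  | cons l t ih => exact ⟨hmn.trans h.1, ih (l.locksAfter_mono hmn) h.2⟩

/-! ### Facts: the elements of the set components of abstract states -/

/-- Wobbly expressions and recorded accesses. -/
abbrev Fact (F : Type*) := Exp F ⊕ (Access F × ℕ)

def AbsState.facts (D : AbsState F) : Set (Fact F) := Sum.inl '' D.W ∪ Sum.inr '' D.A

/-- The facts contributed by a command in the current frame, before resolution. -/
def Label.facts : Label F → ℕ → Set (Fact F)
  | .stmt c, n => Sum.inl '' c.wobbly ∪ Sum.inr '' c.accesses n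
  | .push es, _ => Sum.inl '' aliased es
  | .pop, _ => ∅

namespace Fact

def root : Fact F → Var
  | .inl e => e.root
  | .inr q => q.1.path.root

def subst (θ : List (Exp F)) : Fact F → Fact F
  | .inl e => .inl (e.subst θ)
  | .inr q => .inr (q.1.subst θ, q.2)

noncomputable def resolve (Θ : List (List (Exp F))) : Fact F → Option (Fact F)
  | .inl e => (e.resolve Θ).map .inl
  | .inr q => (q.1.resolve Θ).map fun a => .inr (a, q.2)

/-- Raises the lock context of an access. -/
def shift (j : ℕ) : Fact F → Fact F
  | .inl e => .inl e
  | .inr q => .inr (q.1, q.2 + j)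

end Fact

def resolveFacts (Θ : List (List (Exp F))) (E : Set (Fact F)) : Set (Fact F) :=
  {q' | ∃ q ∈ E, q.resolve Θ = some q'}

@[simp] theorem AbsState.inl_mem_facts {D : AbsState F} {e : Exp F} :
    Sum.inl e ∈ D.facts ↔ e ∈ D.W := by simp [facts]

@[simp] theorem AbsState.inr_mem_facts {D : AbsState F} {q : Access F × ℕ} :
    Sum.inr q ∈ D.facts ↔ q ∈ D.A := by simp [facts]

/-! ### Resolution -/

theorem Exp.root_dot (e : Exp F) (f : F) : (e.dot f).root = e.root := by cases e <;> rfl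

theorem Path.root_subst (θ : List (Exp F)) (π : Path F) :
    (π.subst θ).root = (π.root.subst θ).root := by
  induction π with
  | base x f => exact Exp.root_dot _ _
  | dot π f ih => exact ih

theorem Exp.root_subst (θ : List (Exp F)) (e : Exp F) :
    (e.subst θ).root = (e.root.subst θ).root := by
  cases e
  exacts [rfl, Path.root_subst _ _]

theorem Fact.root_subst (θ : List (Exp F)) (q : Fact F) :
    (q.subst θ).root = (q.root.subst θ).root := by
  rcases q with e | ⟨⟨x, π⟩ | ⟨π, x⟩, n⟩
  exacts [Exp.root_subst _ _, Path.root_subst _ _, Path.root_subst _ _]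

theorem Var.InDom.isFormal {θ : List (Exp F)} {x : Var} (h : x.InDom θ) : x.IsFormal :=
  let ⟨i, hi, _⟩ := h
  ⟨i, hi⟩

/-- The root of a substituted expression is the root of one of the substituted terms. -/
theorem Var.InDom.exists_root_subst {θ : List (Exp F)} {x : Var} (h : x.InDom θ) :
    ∃ e ∈ θ, e.root = (x.subst θ).root := by
  obtain ⟨i, rfl, hi⟩ := h
  exact ⟨θ[i], List.getElem_mem hi, by simp [Var.subst, hi]⟩

open Classical in
theorem Fact.resolve_nil (q : Fact F) :
    q.resolve [] = if q.root.IsFormal then some q else none := by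
  rcases q with e | ⟨⟨x, π⟩ | ⟨π, x⟩, n⟩ <;>
    simp only [resolve, root, Exp.resolve, Access.resolve, Path.resolve, Access.path] <;>
    split_ifs <;> simp_all

open Classical in
theorem Fact.resolve_cons (θ : List (Exp F)) (Θ : List (List (Exp F))) (q : Fact F) :
    q.resolve (θ :: Θ) = if q.root.InDom θ then (q.subst θ).resolve Θ else none := by
  rcases q with e | ⟨⟨x, π⟩ | ⟨π, x⟩, n⟩ <;>
    simp only [resolve, root, Exp.resolve, Access.resolve, Path.resolve, Access.path, subst,
      Access.subst] <;>
    split_ifs <;> simp_all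

theorem Fact.isFormal_of_resolve {Θ : List (List (Exp F))} {q q' : Fact F}
    (h : q.resolve Θ = some q') : q.root.IsFormal := by
  cases Θ with
  | nil => rw [resolve_nil] at h; split_ifs at h with hq; exact hq
  | cons θ Θ => rw [resolve_cons] at h; split_ifs at h with hq; exact hq.isFormal

/-- Resolving through `Θ` ends with a test for formal roots. This intermediate test drops nothing
that would survive `Θ'`, since every successful resolution starts from a formal root. -/
theorem Fact.resolve_append (Θ Θ' : List (List (Exp F))) (q : Fact F) :
    q.resolve (Θ ++ Θ') = (q.resolve Θ).bind (resolve Θ') := by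
  induction Θ generalizing q with
  | nil =>
    rw [resolve_nil]
    split_ifs with h
    · rfl
    · exact Option.eq_none_iff_forall_ne_some.2 fun q' hq' => h (isFormal_of_resolve hq')
  | cons θ Θ ih =>
    rw [List.cons_append, resolve_cons, resolve_cons]
    split_ifs
    exacts [ih _, rfl]

theorem Fact.resolve_shift (Θ : List (List (Exp F))) (j : ℕ) (q : Fact F) :
    (q.shift j).resolve Θ = (q.resolve Θ).map (shift j) := by
  rcases q with e | q <;> simp only [resolve, shift, Option.map_map] <;> rfl

theorem resolveFacts_append (Θ Θ' : List (List (Exp F))) (E : Set (Fact F)) :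
    resolveFacts (Θ ++ Θ') E = resolveFacts Θ' (resolveFacts Θ E) := by
  ext q
  simp only [resolveFacts, Fact.resolve_append, Option.bind_eq_some_iff, Set.mem_ofPred_eq]
  exact ⟨fun ⟨p, hp, r, h, h'⟩ => ⟨r, ⟨p, hp, h⟩, h'⟩, fun ⟨r, ⟨p, hp, h⟩, h'⟩ => ⟨p, hp, r, h, h'⟩⟩

theorem resolveFacts_shift (Θ : List (List (Exp F))) (j : ℕ) (E : Set (Fact F)) :
    resolveFacts Θ (Fact.shift j '' E) = Fact.shift j '' resolveFacts Θ E := by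
  ext q
  simp only [resolveFacts, Set.mem_ofPred_eq, Set.mem_image, exists_exists_and_eq_and,
    Fact.resolve_shift, Option.map_eq_some_iff]
  exact ⟨fun ⟨p, hp, r, h, h'⟩ => ⟨r, ⟨p, hp, h⟩, h'⟩, fun ⟨r, ⟨p, hp, h⟩, h'⟩ => ⟨p, hp, r, h, h'⟩⟩

theorem resolveFacts_union (Θ : List (List (Exp F))) (E E' : Set (Fact F)) :
    resolveFacts Θ (E ∪ E') = resolveFacts Θ E ∪ resolveFacts Θ E' := by
  ext q
  simp only [resolveFacts, Set.mem_ofPred_eq, Set.mem_union, or_and_right, exists_or]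

theorem resolveFacts_empty (Θ : List (List (Exp F))) :
    resolveFacts Θ (∅ : Set (Fact F)) = ∅ := by
  simp [resolveFacts]

theorem mem_resolveFacts_nil {E : Set (Fact F)} {q : Fact F} :
    q ∈ resolveFacts [] E ↔ q ∈ E ∧ q.root.IsFormal := by
  simp only [resolveFacts, Set.mem_ofPred_eq, Fact.resolve_nil]
  constructor
  · rintro ⟨p, hp, h⟩
    split_ifs at h with hf
    cases h
    exact ⟨hp, hf⟩
  · exact fun ⟨hq, hf⟩ => ⟨q, hq, if_pos hf⟩

/-- Lock contexts are recorded without cut-off, so extra held locks translate the facts. -/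
theorem Label.facts_add (l : Label F) (n j : ℕ) :
    l.facts (n + j) = Fact.shift j '' l.facts n := by
  rcases l with c | es | _
  · simp only [facts, Set.image_union, Set.image_image]
    congr 1
    cases c <;> simp [Stmt.accesses, Fact.shift]
  · simp only [facts, Set.image_image, Fact.shift]
  · simp [facts]

theorem resolveFacts_inl (Θ : List (List (Exp F))) (E : Set (Exp F)) :
    resolveFacts Θ (Sum.inl '' E : Set (Fact F)) = Sum.inl '' resolveSet Θ E := by
  ext q
  simp only [resolveFacts, resolveSet, Set.mem_ofPred_eq, Set.mem_image, exists_exists_and_eq_and,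
    Fact.resolve, Option.map_eq_some_iff]
  exact ⟨fun ⟨p, hp, r, h, h'⟩ => ⟨r, ⟨p, hp, h⟩, h'⟩, fun ⟨r, ⟨p, hp, h⟩, h'⟩ => ⟨p, hp, r, h, h'⟩⟩

theorem resolveFacts_inr (Θ : List (List (Exp F))) (A : Set (Access F × ℕ)) :
    resolveFacts Θ (Sum.inr '' A : Set (Fact F)) = Sum.inr '' resolveSetA Θ A := by
  ext q
  simp only [resolveFacts, resolveSetA, Set.mem_ofPred_eq, Set.mem_image, exists_exists_and_eq_and,
    Fact.resolve, Option.map_eq_some_iff]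
  constructor
  · rintro ⟨⟨a, n⟩, hp, r, h, rfl⟩
    exact ⟨(r, n), ⟨a, hp, h⟩, rfl⟩
  · rintro ⟨⟨r, n⟩, ⟨a, hp, h⟩, rfl⟩
    exact ⟨(a, n), hp, r, h, rfl⟩

/-! ### Facts collected along a list of commands -/

/-- The effect of a command on the stack of substitutions and the lock count; `none` for a `pop`
or an `unlock` without counterpart. -/
def Label.next : Label F → List (List (Exp F)) × ℕ → Option (List (List (Exp F)) × ℕ)
  | .stmt c, (Θ, n) => (c.pending n).map (Prod.mk Θ)
  | .push es, (Θ, n) => some (es :: Θ, n)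
  | .pop, (_ :: Θ, n) => some (Θ, n)
  | .pop, ([], _) => none

/-- A command that succeeds inspects at most the top of the stack and the locks it needs, so
anything may be added underneath. -/
theorem Label.next_append {l : Label F} {σ σ' : List (List (Exp F)) × ℕ} (h : l.next σ = some σ')
    (Φ : List (List (Exp F))) (j : ℕ) : l.next (σ.1 ++ Φ, σ.2 + j) = some (σ'.1 ++ Φ, σ'.2 + j) := by
  rcases σ with ⟨_ | ⟨θ, Θ⟩, n⟩ <;> rcases l with c | es | _ <;>
    simp only [next, Option.map_eq_some_iff, Option.some.injEq, reduceCtorEq] at h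
  all_goals
    first
    | (obtain ⟨k, hk, rfl⟩ := h; simp [next, Stmt.pending_add hk])
    | (subst h; simp [next])

theorem Label.locksAfter_of_next {l : Label F} {σ σ' : List (List (Exp F)) × ℕ}
    (h : l.next σ = some σ') (j : ℕ) : l.locksAfter (σ.2 + j) = σ'.2 + j := by
  rcases σ with ⟨_ | ⟨θ, Θ⟩, _ | n⟩ <;> rcases l with (_ | _ | _ | _ | _ | _ | _) | es | _ <;>
    simp [next, Stmt.pending] at h <;> subst h <;> simp [locksAfter] <;> omega

/-- `Steps σ t E σ'`: the commands of `t` lead from `σ` to `σ'` and contribute the facts `E`. -/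
inductive Steps : List (List (Exp F)) × ℕ → List (Label F) → Set (Fact F) →
    List (List (Exp F)) × ℕ → Prop
  | nil (σ) : Steps σ [] ∅ σ
  | cons {σ σ' σ'' l t E} : l.next σ = some σ' → Steps σ' t E σ'' →
      Steps σ (l :: t) (resolveFacts σ.1 (l.facts σ.2) ∪ E) σ''

theorem Steps.single {σ σ' : List (List (Exp F)) × ℕ} {l : Label F} (h : l.next σ = some σ') :
    Steps σ [l] (resolveFacts σ.1 (l.facts σ.2)) σ' := by
  simpa using Steps.cons h (.nil σ')

theorem Steps.append {σ σ' σ'' : List (List (Exp F)) × ℕ} {t t' : List (Label F)}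
    {E E' : Set (Fact F)} (h : Steps σ t E σ') (h' : Steps σ' t' E' σ'') :
    Steps σ (t ++ t') (E ∪ E') σ'' := by
  induction h with
  | nil σ => simpa using h'
  | cons hl _ ih =>
    rw [Set.union_assoc]
    exact .cons hl (ih h')

/-- Facts collected in a deeper context are instances of those collected in a shallower one. -/
theorem Steps.instantiate {σ σ' : List (List (Exp F)) × ℕ} {t : List (Label F)} {E : Set (Fact F)}
    (h : Steps σ t E σ') (Φ : List (List (Exp F))) (j : ℕ) :
    Steps (σ.1 ++ Φ, σ.2 + j) t (Fact.shift j '' resolveFacts Φ E) (σ'.1 ++ Φ, σ'.2 + j) := by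
  induction h with
  | nil σ => simpa only [resolveFacts_empty, Set.image_empty] using Steps.nil _
  | @cons σ σ' σ'' l t E hl _ ih =>
    -- Shifting commutes with resolution, so the facts of the first command take the form they have
    -- in the deeper context.
    rw [resolveFacts_union, Set.image_union, ← resolveFacts_append, ← resolveFacts_shift,
      ← Label.facts_add]
    exact Steps.cons (σ := (σ.1 ++ Φ, σ.2 + j)) (Label.next_append hl Φ j) ih

/-- Inverting an `Unfolds` splits the command list but not `E`; uniqueness identifies `E` with the
union over the pieces. -/
theorem Steps.unique {σ σ₁ σ₂ : List (List (Exp F)) × ℕ} {t : List (Label F)}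
    {E₁ E₂ : Set (Fact F)} (h₁ : Steps σ t E₁ σ₁) (h₂ : Steps σ t E₂ σ₂) : E₁ = E₂ := by
  induction h₁ generalizing E₂ with
  | nil σ => cases h₂; rfl
  | cons hl _ ih =>
    cases h₂ with
    | cons hl' h' =>
      obtain rfl := Option.some.inj (hl.symm.trans hl')
      rw [ih h']

theorem Steps.locksAfter {σ σ' : List (List (Exp F)) × ℕ} {t : List (Label F)} {E : Set (Fact F)}
    (h : Steps σ t E σ') : locksAfter t σ.2 = σ'.2 := by
  induction h with
  | nil σ => rfl
  | cons hl _ ih =>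
    have := Label.locksAfter_of_next hl 0
    rw [add_zero, add_zero] at this
    rwa [← this] at ih

/-- The recorded lock context is the lock count at the moment of the access. For a summary used with
`j` locks held, this makes `addLock` an ordinary sum. -/
theorem Steps.access_le {Lhat : ℕ} {σ σ' : List (List (Exp F)) × ℕ} {t : List (Label F)}
    {E : Set (Fact F)} (h : Steps σ t E σ') {j : ℕ} (hb : Bounded Lhat t (σ.2 + j))
    {q : Access F × ℕ} (hq : Sum.inr q ∈ E) : q.2 + j ≤ Lhat := by
  induction h with
  | nil σ => exact hq.elim
  | @cons σ σ' σ'' l t E hl _ ih =>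
    rcases hq with ⟨p, hp, hr⟩ | hq
    · suffices q.2 = σ.2 by rw [this]; exact hb.1
      rcases p with e | p
      · simp [Fact.resolve] at hr
      · simp only [Fact.resolve, Option.map_eq_some_iff] at hr
        obtain ⟨a, -, ha⟩ := hr
        obtain rfl := Sum.inr.inj ha
        rcases l with (_ | _ | _ | _ | _ | _ | _) | es | _ <;>
          simp [Label.facts, Stmt.accesses] at hp <;> simp [hp]
    · refine ih ?_ hq
      rw [← Label.locksAfter_of_next hl]
      exact hb.2

theorem Stmt.exists_steps {c : Stmt F} {n k : ℕ} (h : c.pending n = some k)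
    (Θ : List (List (Exp F))) :
    Steps (Θ, n) c.labels (resolveFacts Θ ((Label.stmt c).facts n)) (Θ, k) := by
  have h' : (Label.stmt c).next (Θ, n) = some (Θ, k) := by simp [Label.next, h]
  cases c
  -- `skip` leaves no label, but it has no facts either.
  case skip =>
    simp only [Stmt.pending, Option.some.injEq] at h
    subst h
    have : (Label.stmt (.skip : Stmt F)).facts n = ∅ := by
      simp [Label.facts, Stmt.wobbly, Stmt.accesses]
    rw [this, resolveFacts_empty]
    exact .nil _
  all_goals exact Steps.single h'

/-- The body is traversed in isolation, from the empty stack and lock count `0`, and then moved by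
`Steps.instantiate` under `es` and `k` held locks. -/
theorem Steps.call {C : List (Label F)} {n : ℕ} {E E' : Set (Fact F)} {k : ℕ} {t : List (Label F)}
    (h : Steps ([], n) C E ([], k)) (h' : Steps ([], 0) t E' ([], 0)) (es : List (Exp F)) :
    Steps ([], n) (C ++ (.push es :: (t ++ [.pop])))
      (E ∪ (resolveFacts [] (Sum.inl '' aliased es) ∪ Fact.shift k '' resolveFacts [es] E'))
      ([], k) := by
  refine h.append (Steps.cons (σ := ([], k)) (σ' := ([es], k)) rfl ?_)
  have h₁ := (h'.instantiate [es] k).append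
    (Steps.single (l := .pop) (σ' := ([], k)) (by simp [Label.next]))
  simpa [Label.facts, resolveFacts_empty] using h₁

theorem Unfolds.exists_steps {P : Methods F M} (hbal : ∀ m, (P.body m).pending 0 = some 0)
    {C : CStmt F M} {t : List (Label F)} (h : Unfolds P C t) {n k : ℕ}
    (hp : C.pending n = some k) : ∃ E, Steps ([], n) t E ([], k) := by
  induction h generalizing n k with
  | simple c => exact ⟨_, Stmt.exists_steps hp []⟩
  | seq c _ ih =>
    simp only [CStmt.pending, Option.bind_eq_some_iff] at hp
    obtain ⟨i, hi, hc⟩ := hp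
    obtain ⟨E, hE⟩ := ih hi
    exact ⟨_, hE.append (Stmt.exists_steps hc [])⟩
  | ite_left _ _ ih ih' =>
    obtain ⟨h, h₁, -⟩ := CStmt.pending_ite hp
    obtain ⟨E, hE⟩ := ih h
    obtain ⟨E', hE'⟩ := ih' (CStmt.pending_self h₁ k)
    exact ⟨_, hE.append hE'⟩
  | ite_right _ _ ih ih' =>
    obtain ⟨h, -, h₁⟩ := CStmt.pending_ite hp
    obtain ⟨E, hE⟩ := ih h
    obtain ⟨E', hE'⟩ := ih' (CStmt.pending_self h₁ k)
    exact ⟨_, hE.append hE'⟩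
  | loop_exit _ ih => exact ih (CStmt.pending_loop hp).1
  | loop_iter _ _ ih ih' =>
    obtain ⟨E, hE⟩ := ih hp
    obtain ⟨E', hE'⟩ := ih' (CStmt.pending_self (CStmt.pending_loop hp).2 k)
    exact ⟨_, hE.append hE'⟩
  | call es _ _ ih ih' =>
    obtain ⟨E, hE⟩ := ih hp
    obtain ⟨E', hE'⟩ := ih' (hbal _)
    exact ⟨_, hE.call hE' es⟩

/-- Execution of a list of commands yields exactly the facts collected along it. -/
theorem Steps.exec {Lhat : ℕ} {σ σ' : List (List (Exp F)) × ℕ} {t : List (Label F)}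
    {E : Set (Fact F)} (h : Steps σ t E σ') (hb : Bounded Lhat t σ.2) {D : AbsState F}
    (hD : D.L = σ.2) : (exec Lhat t (D, σ.1)).1.L = σ'.2 ∧
      (exec Lhat t (D, σ.1)).1.facts = D.facts ∪ E := by
  induction h generalizing D with
  | nil σ => exact ⟨hD, by simp [RacerDX.exec]⟩
  | @cons σ σ' σ'' l t E hl ht ih =>
    have hlock := Label.locksAfter_of_next hl 0
    simp only [add_zero] at hlock
    have hb' : Bounded Lhat t σ'.2 := hlock ▸ hb.2
    have key : (execStep Lhat (D, σ.1) l).2 = σ'.1 ∧ (execStep Lhat (D, σ.1) l).1.L = σ'.2 ∧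
        (execStep Lhat (D, σ.1) l).1.facts = D.facts ∪ resolveFacts σ.1 (l.facts σ.2) := by
      rcases σ with ⟨Θ, n⟩
      obtain ⟨W, L, A⟩ := D
      simp only at hD
      subst hD
      rcases l with c | es | _
      · simp only [Label.next, Option.map_eq_some_iff] at hl
        obtain ⟨k, hk, rfl⟩ := hl
        refine ⟨rfl, ?_, ?_⟩
        · simp only [execStep]
          -- The count after the command is at most `Lhat`, so `addLock` does not cut off in the
          -- `lock` case.
          have := hb'.head_le
          cases c <;> simp_all [Stmt.locking, Label.locksAfter, addLock]
        · simp only [execStep, Label.facts, resolveFacts_union, resolveFacts_inl, resolveFacts_inr,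
            AbsState.facts, Set.image_union]
          exact Set.union_union_union_comm ..
      · simp only [Label.next, Option.some.injEq] at hl
        subst hl
        refine ⟨rfl, rfl, ?_⟩
        simp only [execStep, Label.facts, resolveFacts_inl, AbsState.facts, Set.image_union]
        exact Set.union_right_comm ..
      · cases Θ with
        | nil => cases hl
        | cons θ Θ =>
          simp only [Label.next, Option.some.injEq] at hl
          subst hl
          refine ⟨rfl, rfl, ?_⟩
          simp [execStep, Label.facts, resolveFacts_empty]
    obtain ⟨h₁, h₂, h₃⟩ := key
    have := ih hb' h₂
    rw [h₃, ← h₁, Set.union_assoc] at this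
    exact this

end
end RacerDX
namespace RacerDX

/-! ### The analysis collects the facts of all syntactic runs -/

section
variable {F M : Type*}

/-- Some syntactic run of `C` contributes the fact `q`, when the lock count goes from `n` to `k`. -/
def Reaches (P : Methods F M) (C : CStmt F M) (n k : ℕ) (q : Fact F) : Prop :=
  ∃ t E, Unfolds P C t ∧ Steps ([], n) t E ([], k) ∧ q ∈ E

/-- The lock count stays below `Lhat` in all syntactic runs of `C` starting with `n`. -/
def Fits (P : Methods F M) (Lhat : ℕ) (C : CStmt F M) (n : ℕ) : Prop :=
  ∀ t, Unfolds P C t → Bounded Lhat t n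

variable {P : Methods F M}

theorem CStmt.pending_seq {C : CStmt F M} {c : Stmt F} {n k : ℕ}
    (h : (CStmt.seq C c).pending n = some k) :
    ∃ i, C.pending n = some i ∧ c.pending i = some k := by
  simpa only [pending, Option.bind_eq_some_iff] using h

section Reaches
variable (hP : P.NonRecursive) (hbal : ∀ m, (P.body m).pending 0 = some 0)
include hP hbal

theorem exists_unfolds_steps {C : CStmt F M} {n k : ℕ} (hp : C.pending n = some k) :
    ∃ t E, Unfolds P C t ∧ Steps ([], n) t E ([], k) :=
  let ⟨t, ht⟩ := hP.exists_unfolds C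
  let ⟨E, hE⟩ := ht.exists_steps hbal hp
  ⟨t, E, ht, hE⟩

omit hP hbal in
theorem reaches_simple {c : Stmt F} {n k : ℕ} (hp : c.pending n = some k) (q : Fact F) :
    Reaches P (.simple c) n k q ↔ q ∈ resolveFacts [] ((Label.stmt c).facts n) := by
  constructor
  · rintro ⟨t, E, ht, hE, hq⟩
    cases ht
    rwa [hE.unique (Stmt.exists_steps hp [])] at hq
  · exact fun hq => ⟨_, _, .simple c, Stmt.exists_steps hp [], hq⟩

theorem reaches_seq {C : CStmt F M} {c : Stmt F} {n i k : ℕ} (hi : C.pending n = some i)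
    (hc : c.pending i = some k) (q : Fact F) :
    Reaches P (.seq C c) n k q ↔
      Reaches P C n i q ∨ q ∈ resolveFacts [] ((Label.stmt c).facts i) := by
  constructor
  · rintro ⟨_, E, ht, hE, hq⟩
    cases ht with
    | seq _ ht =>
      obtain ⟨E', hE'⟩ := ht.exists_steps hbal hi
      rw [hE.unique (hE'.append (Stmt.exists_steps hc []))] at hq
      exact hq.imp_left fun hq => ⟨_, _, ht, hE', hq⟩
  · rintro (⟨t, E, ht, hE, hq⟩ | hq)
    · exact ⟨_, _, ht.seq c, hE.append (Stmt.exists_steps hc []), Or.inl hq⟩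
    · obtain ⟨t, E, ht, hE⟩ := exists_unfolds_steps hP hbal hi
      exact ⟨_, _, ht.seq c, hE.append (Stmt.exists_steps hc []), Or.inr hq⟩

theorem reaches_ite {C C₁ C₂ : CStmt F M} {n k : ℕ} (hp : C.pending n = some k)
    (h₁ : C₁.pending k = some k) (h₂ : C₂.pending k = some k) (q : Fact F) :
    Reaches P (.ite C C₁ C₂) n k q ↔
      Reaches P C n k q ∨ Reaches P C₁ k k q ∨ Reaches P C₂ k k q := by
  constructor
  · rintro ⟨_, E, ht, hE, hq⟩
    cases ht with
    | ite_left ht ht' =>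
      obtain ⟨E', hE'⟩ := ht.exists_steps hbal hp
      obtain ⟨E'', hE''⟩ := ht'.exists_steps hbal h₁
      rw [hE.unique (hE'.append hE'')] at hq
      exact hq.imp (fun hq => ⟨_, _, ht, hE', hq⟩) fun hq => Or.inl ⟨_, _, ht', hE'', hq⟩
    | ite_right ht ht' =>
      obtain ⟨E', hE'⟩ := ht.exists_steps hbal hp
      obtain ⟨E'', hE''⟩ := ht'.exists_steps hbal h₂
      rw [hE.unique (hE'.append hE'')] at hq
      exact hq.imp (fun hq => ⟨_, _, ht, hE', hq⟩) fun hq => Or.inr ⟨_, _, ht', hE'', hq⟩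
  · obtain ⟨t, E, ht, hE⟩ := exists_unfolds_steps hP hbal hp
    obtain ⟨t₁, E₁, ht₁, hE₁⟩ := exists_unfolds_steps hP hbal h₁
    rintro (⟨_, _, ht, hE, hq⟩ | ⟨_, _, ht₁, hE₁, hq⟩ | ⟨_, _, ht₂, hE₂, hq⟩)
    · exact ⟨_, _, ht.ite_left ht₁, hE.append hE₁, Or.inl hq⟩
    · exact ⟨_, _, ht.ite_left ht₁, hE.append hE₁, Or.inr hq⟩
    · exact ⟨_, _, ht.ite_right ht₂, hE.append hE₂, Or.inr hq⟩

/-- Each iteration starts with lock count `k`, so any fact of any iteration is already a fact of a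
single traversal of `C'`. -/
theorem reaches_loop {C C' : CStmt F M} {n k : ℕ} (hp : C.pending n = some k)
    (h' : C'.pending k = some k) (q : Fact F) :
    Reaches P (.loop C C') n k q ↔ Reaches P C n k q ∨ Reaches P C' k k q := by
  constructor
  · rintro ⟨t, E, ht, hE, hq⟩
    -- Induction on the path needs a variable index `B`. The facts of the shorter loop path are
    -- carried along to be joined with those of the last iteration.
    suffices ∀ B, Unfolds P B t → B = .loop C C' → ∃ E, Steps ([], n) t E ([], k) ∧
        ∀ q ∈ E, Reaches P C n k q ∨ Reaches P C' k k q by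
      obtain ⟨E', hE', H⟩ := this _ ht rfl
      rw [hE.unique hE'] at hq
      exact H q hq
    clear hE hq ht E
    intro B hB e
    induction hB with
    | loop_exit ht =>
      cases e
      obtain ⟨E, hE⟩ := ht.exists_steps hbal hp
      exact ⟨E, hE, fun q hq => Or.inl ⟨_, _, ht, hE, hq⟩⟩
    | loop_iter _ ht' ih =>
      cases e
      obtain ⟨E, hE, H⟩ := ih rfl
      obtain ⟨E', hE'⟩ := ht'.exists_steps hbal h'
      exact ⟨_, hE.append hE', fun q hq => hq.elim (H q) fun hq => Or.inr ⟨_, _, ht', hE', hq⟩⟩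
    | _ => cases e
  · rintro (⟨t, E, ht, hE, hq⟩ | ⟨t', E', ht', hE', hq⟩)
    · exact ⟨_, _, .loop_exit ht, hE, hq⟩
    · obtain ⟨t, E, ht, hE⟩ := exists_unfolds_steps hP hbal hp
      exact ⟨_, _, .loop_iter (.loop_exit ht) ht', hE.append hE', Or.inr hq⟩

theorem reaches_call {C : CStmt F M} {m : M} {es : List (Exp F)} {n k : ℕ}
    (hp : C.pending n = some k) (q : Fact F) :
    Reaches P (.call C m es) n k q ↔ Reaches P C n k q ∨
      q ∈ resolveFacts [] (Sum.inl '' aliased es) ∨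
      q ∈ Fact.shift k '' resolveFacts [es] {p | Reaches P (P.body m) 0 0 p} := by
  constructor
  · rintro ⟨_, E, ht, hE, hq⟩
    cases ht with
    | call _ ht ht' =>
      obtain ⟨E', hE'⟩ := ht.exists_steps hbal hp
      obtain ⟨E'', hE''⟩ := ht'.exists_steps hbal (hbal m)
      rw [hE.unique (hE'.call hE'' es)] at hq
      refine hq.imp (fun hq => ⟨_, _, ht, hE', hq⟩) (Or.imp_right ?_)
      rintro ⟨p', ⟨p, hp, hpp⟩, rfl⟩
      exact ⟨p', ⟨p, ⟨_, _, ht', hE'', hp⟩, hpp⟩, rfl⟩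
  · obtain ⟨t, E, ht, hE⟩ := exists_unfolds_steps hP hbal hp
    obtain ⟨t', E', ht', hE'⟩ := exists_unfolds_steps hP hbal (hbal m)
    rintro (⟨_, _, ht, hE, hq⟩ | hq | ⟨p', ⟨p, ⟨_, _, ht', hE', hq⟩, hpp⟩, rfl⟩)
    · exact ⟨_, _, ht.call es ht', hE.call hE' es, Or.inl hq⟩
    · exact ⟨_, _, ht.call es ht', hE.call hE' es, Or.inr (Or.inl hq)⟩
    · exact ⟨_, _, ht.call es ht', hE.call hE' es, Or.inr (Or.inr ⟨p', ⟨p, hq, hpp⟩, rfl⟩)⟩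

/-! ### Lock bounds inherited by the parts of a statement. -/

omit hP in
theorem Unfolds.locksAfter {C : CStmt F M} {t : List (Label F)} (h : Unfolds P C t) {n k : ℕ}
    (hp : C.pending n = some k) : locksAfter t n = k :=
  let ⟨_, hE⟩ := h.exists_steps hbal hp
  hE.locksAfter

omit hP hbal in
/-- If all continuations of the runs of `C` fit, so do the runs of `C`. -/
theorem Fits.of_append {Lhat n : ℕ} {B C : CStmt F M} (h : Fits P Lhat B n)
    (H : ∀ t, Unfolds P C t → ∃ t', Unfolds P B (t ++ t')) : Fits P Lhat C n := fun t ht =>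
  let ⟨_, ht'⟩ := H t ht
  (bounded_append.1 (h _ ht')).1

theorem Fits.seq_right {Lhat n i : ℕ} {C : CStmt F M} {c : Stmt F}
    (h : Fits P Lhat (.seq C c) n) (hi : C.pending n = some i) : Bounded Lhat c.labels i := by
  obtain ⟨t, ht⟩ := hP.exists_unfolds C
  have := (bounded_append.1 (h _ (ht.seq c))).2
  rwa [ht.locksAfter hbal hi] at this

theorem Fits.ite_right {Lhat n k : ℕ} {C C₁ C₂ : CStmt F M}
    (h : Fits P Lhat (.ite C C₁ C₂) n) (hp : C.pending n = some k) :
    Fits P Lhat C₁ k ∧ Fits P Lhat C₂ k := by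
  obtain ⟨t, ht⟩ := hP.exists_unfolds C
  rw [← ht.locksAfter hbal hp]
  exact ⟨fun t' ht' => (bounded_append.1 (h _ (ht.ite_left ht'))).2,
    fun t' ht' => (bounded_append.1 (h _ (ht.ite_right ht'))).2⟩

theorem Fits.loop_right {Lhat n k : ℕ} {C C' : CStmt F M}
    (h : Fits P Lhat (.loop C C') n) (hp : C.pending n = some k) : Fits P Lhat C' k := by
  obtain ⟨t, ht⟩ := hP.exists_unfolds C
  rw [← ht.locksAfter hbal hp]
  exact fun t' ht' => (bounded_append.1 (h _ (.loop_iter (.loop_exit ht) ht'))).2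

theorem Fits.call_body {Lhat n k : ℕ} {C : CStmt F M} {m : M} {es : List (Exp F)}
    (h : Fits P Lhat (.call C m es) n) (hp : C.pending n = some k) :
    Fits P Lhat (P.body m) k := by
  obtain ⟨t, ht⟩ := hP.exists_unfolds C
  rw [← ht.locksAfter hbal hp]
  exact fun t' ht' =>
    (bounded_append.1 (bounded_append.1 (h _ (ht.call es ht'))).2.2).1

end Reaches

/-! ### Equations of the analysis on facts -/

@[simp] theorem AbsState.facts_bot : (AbsState.bot : AbsState F).facts = ∅ := by
  simp [facts, bot]

theorem AbsState.facts_join (D D' : AbsState F) : (D.join D').facts = D.facts ∪ D'.facts := by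
  simp only [facts, join, Set.image_union]
  exact Set.union_union_union_comm ..

theorem Stmt.facts_analyze (Lhat : ℕ) (c : Stmt F) (D : AbsState F) :
    (c.analyze Lhat D).facts = D.facts ∪ resolveFacts [] ((Label.stmt c).facts D.L) := by
  ext q
  rw [Set.mem_union, mem_resolveFacts_nil]
  rcases q with e | q <;> simp [analyze, Label.facts, fml, fmlA, Fact.root]

theorem Stmt.analyze_L {Lhat k : ℕ} {c : Stmt F} {D : AbsState F} (h : c.pending D.L = some k)
    (hb : Bounded Lhat c.labels D.L) : (c.analyze Lhat D).L = k := by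
  obtain ⟨W, L, A⟩ := D
  cases c <;> cases L <;>
    simp_all [analyze, locking, Stmt.pending, addLock, labels, Bounded, Label.locksAfter]

/-- Resolution drops roots outside the domain whereas substitution leaves them alone; `hE` excludes
the case where they differ. -/
theorem mem_resolveFacts_singleton {es : List (Exp F)} {E : Set (Fact F)}
    (hE : ∀ q ∈ E, q.root.InDom es) (q : Fact F) :
    q ∈ resolveFacts [es] E ↔ (∃ p ∈ E, p.subst es = q) ∧ q.root.IsFormal := by
  simp only [resolveFacts, Set.mem_ofPred_eq, Fact.resolve_cons, Fact.resolve_nil]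
  constructor
  · rintro ⟨p, hp, h⟩
    rw [if_pos (hE p hp)] at h
    split_ifs at h with hf
    cases h
    exact ⟨⟨p, hp, rfl⟩, hf⟩
  · rintro ⟨⟨p, hp, rfl⟩, hf⟩
    exact ⟨p, hp, by rw [if_pos (hE p hp), if_pos hf]⟩

/-- The first hypothesis turns substitution into resolution, the second makes the cut-off in lock
contexts inactive. -/
theorem facts_applySummary {Lhat : ℕ} {es : List (Exp F)} {D' D : AbsState F}
    (hroot : ∀ q ∈ D'.facts, q.root.InDom es) (hL : ∀ q ∈ D'.A, q.2 + D.L ≤ Lhat) :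
    (applySummary Lhat es D' D).facts = D.facts ∪ (resolveFacts [] (Sum.inl '' aliased es) ∪
      Fact.shift D.L '' resolveFacts [es] D'.facts) := by
  have hlock : ∀ q ∈ D'.A, addLock Lhat D.L q.2 = q.2 + D.L := fun q hq => by
    have := hL q hq
    simp only [addLock]
    omega
  ext q
  simp only [Set.mem_union, mem_resolveFacts_nil, Set.mem_image, mem_resolveFacts_singleton hroot]
  rcases q with e | ⟨a, n⟩
  · simp only [AbsState.inl_mem_facts, applySummary, fml, Set.mem_union, Set.mem_ofPred_eq,
      Set.mem_image, or_assoc]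
    refine or_congr_right (or_congr (by simp [Fact.root]) ?_)
    constructor
    · rintro ⟨⟨w, hw, rfl⟩, hf⟩
      exact ⟨.inl (w.subst es), ⟨⟨.inl w, by simpa using hw, rfl⟩, hf⟩, rfl⟩
    · rintro ⟨p, ⟨⟨r, hr, rfl⟩, hf⟩, h⟩
      rcases r with w | r
      · cases h
        exact ⟨⟨w, by simpa using hr, rfl⟩, hf⟩
      · cases h
  · simp only [AbsState.inr_mem_facts, applySummary, fmlA, Set.mem_union, Set.mem_ofPred_eq,
      Set.mem_image]
    refine or_congr_right ?_
    -- Aliased arguments contribute no accesses.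
    rw [or_iff_right (by simp)]
    constructor
    · rintro ⟨⟨w, hw, h⟩, hf⟩
      rw [hlock w hw] at h
      cases h
      exact ⟨.inr (w.1.subst es, w.2), ⟨⟨.inr w, by simpa using hw, rfl⟩, hf⟩, rfl⟩
    · rintro ⟨p, ⟨⟨r, hr, rfl⟩, hf⟩, h⟩
      rcases r with w | r
      · cases h
      · have hr' := AbsState.inr_mem_facts.1 hr
        cases h
        exact ⟨⟨r, hr', by rw [hlock r hr']⟩, hf⟩

/-- Facts found by the analysis are rooted at formals occurring in the analyzed statement. -/
theorem CStmt.root_of_mem_facts_analyzeWith {Lhat : ℕ} {sm : M → AbsState F} {C : CStmt F M}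
    (hC : C.ArityOK P)
    (hsm : ∀ m ∈ C.callees, ∀ q ∈ (sm m).facts, q.root ∈ formals (P.arity m))
    {D : AbsState F} {q : Fact F} (hq : q ∈ (C.analyzeWith Lhat sm D).facts) :
    q ∈ D.facts ∨ q.root ∈ C.vars ∧ q.root.IsFormal := by
  have stmt : ∀ (c : Stmt F) (n : ℕ), ∀ q ∈ resolveFacts [] ((Label.stmt c).facts n),
      q.root ∈ c.vars ∧ q.root.IsFormal := by
    intro c n q hq
    rw [mem_resolveFacts_nil] at hq
    refine ⟨?_, hq.2⟩
    rcases q with e | q <;> cases c <;>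
      simp [Label.facts, Stmt.wobbly, Stmt.accesses, Stmt.vars, Fact.root] at hq ⊢ <;>
      rcases hq with ⟨rfl | rfl, -⟩ <;> simp [Exp.root, Access.path]
  induction C generalizing D q with
  | simple c =>
    rw [analyzeWith, Stmt.facts_analyze] at hq
    exact hq.imp_right (stmt c _ q)
  | seq C c ih =>
    rw [analyzeWith, Stmt.facts_analyze] at hq
    rcases hq with hq | hq
    · exact (ih hC hsm hq).imp_right (And.imp_left Or.inl)
    · exact Or.inr ((stmt c _ q hq).imp_left Or.inr)
  | ite C C₁ C₂ ih ih₁ ih₂ =>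
    rw [analyzeWith, AbsState.facts_join] at hq
    have h : q ∈ (C.analyzeWith Lhat sm D).facts → _ :=
      ih hC.1 fun m hm => hsm m (Or.inl (Or.inl hm))
    rcases hq with hq | hq
    · rcases ih₁ hC.2.1 (fun m hm => hsm m (Or.inl (Or.inr hm))) hq with hq | hq
      · exact (h hq).imp_right (And.imp_left fun h => Or.inl (Or.inl h))
      · exact Or.inr (hq.imp_left fun h => Or.inl (Or.inr h))
    · rcases ih₂ hC.2.2 (fun m hm => hsm m (Or.inr hm)) hq with hq | hq
      · exact (h hq).imp_right (And.imp_left fun h => Or.inl (Or.inl h))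
      · exact Or.inr (hq.imp_left Or.inr)
  | loop C C' ih ih' =>
    rw [analyzeWith, AbsState.facts_join] at hq
    have h : q ∈ (C.analyzeWith Lhat sm D).facts → _ := ih hC.1 fun m hm => hsm m (Or.inl hm)
    rcases hq with hq | hq
    · exact (h hq).imp_right (And.imp_left Or.inl)
    · rcases ih' hC.2 (fun m hm => hsm m (Or.inr hm)) hq with hq | hq
      · exact (h hq).imp_right (And.imp_left Or.inl)
      · exact Or.inr (hq.imp_left Or.inr)
  | call C m es ih =>
    have h : q ∈ (C.analyzeWith Lhat sm D).facts → _ := ih hC.1 fun m hm => hsm m (Or.inl hm)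
    have hal : ∀ e ∈ aliased es, e.root ∈ (CStmt.call C m es).vars := by
      rintro e ⟨i, -, -, -, hi, -⟩
      exact Or.inr ⟨e, List.mem_of_getElem? hi, rfl⟩
    -- Since arities agree, a formal of the callee is in the domain of `es`, so the instantiated
    -- fact is rooted where some argument is.
    have hsub : ∀ p ∈ (sm m).facts, (p.subst es).root ∈ (CStmt.call C m es).vars := by
      intro p hp
      rw [Fact.root_subst]
      obtain ⟨i, hi, hp⟩ := hsm m (Or.inr rfl) p hp
      exact Or.inr (Var.InDom.exists_root_subst ⟨i, hp, hC.2 ▸ hi⟩)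
    rcases q with e | ⟨a, n⟩
    · simp only [AbsState.inl_mem_facts, analyzeWith, applySummary, fml, Set.mem_union,
        Set.mem_ofPred_eq, Set.mem_image] at hq
      rcases hq with (hq | ⟨hq, hf⟩) | ⟨⟨w, hw, rfl⟩, hf⟩
      · exact (h (AbsState.inl_mem_facts.2 hq)).imp_right (And.imp_left Or.inl)
      · exact Or.inr ⟨hal e hq, hf⟩
      · exact Or.inr ⟨hsub (.inl w) (by simpa using hw), hf⟩
    · simp only [AbsState.inr_mem_facts, analyzeWith, applySummary, fmlA, Set.mem_union,
        Set.mem_ofPred_eq, Set.mem_image] at hq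
      rcases hq with hq | ⟨⟨w, hw, hwq⟩, hf⟩
      · exact (h (AbsState.inr_mem_facts.2 hq)).imp_right (And.imp_left Or.inl)
      · cases hwq
        exact Or.inr ⟨hsub (.inr w) (by simpa using hw), hf⟩

/-- If the summaries of the callees are exact, so is the analysis. -/
theorem CStmt.analyzeWith_exact (hP : P.NonRecursive)
    (hbal : ∀ m, (P.body m).pending 0 = some 0) {Lhat : ℕ} {sm : M → AbsState F} {C : CStmt F M}
    (hC : C.ArityOK P)
    (hroot : ∀ m ∈ C.callees, ∀ q ∈ (sm m).facts, q.root ∈ formals (P.arity m))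
    (hsm : ∀ m ∈ C.callees, Fits P Lhat (P.body m) 0 →
      (sm m).L = 0 ∧ ∀ q, q ∈ (sm m).facts ↔ Reaches P (P.body m) 0 0 q)
    {D : AbsState F} {k : ℕ} (hp : C.pending D.L = some k) (hfit : Fits P Lhat C D.L) :
    (C.analyzeWith Lhat sm D).L = k ∧
      ∀ q, q ∈ (C.analyzeWith Lhat sm D).facts ↔ q ∈ D.facts ∨ Reaches P C D.L k q := by
  induction C generalizing D k with
  | simple c =>
    refine ⟨Stmt.analyze_L hp (hfit _ (.simple c)), fun q => ?_⟩
    rw [analyzeWith, Stmt.facts_analyze, reaches_simple hp]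
    rfl
  | seq C c ih =>
    obtain ⟨i, hi, hc⟩ := pending_seq hp
    obtain ⟨hL, hq⟩ := ih hC hroot hsm hi
      (hfit.of_append fun t ht => ⟨_, ht.seq c⟩)
    refine ⟨Stmt.analyze_L (hL ▸ hc) (hL ▸ hfit.seq_right hP hbal hi), fun q => ?_⟩
    rw [analyzeWith, Stmt.facts_analyze, reaches_seq hP hbal hi hc, Set.mem_union, hq, hL, or_assoc]
  | ite C C₁ C₂ ih ih₁ ih₂ =>
    obtain ⟨hi, h₁, h₂⟩ := pending_ite hp
    obtain ⟨hf₁, hf₂⟩ := hfit.ite_right hP hbal hi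
    obtain ⟨hL, hq⟩ := ih hC.1 (fun m hm => hroot m (Or.inl (Or.inl hm)))
      (fun m hm => hsm m (Or.inl (Or.inl hm))) hi
      (hfit.of_append fun t ht => ⟨_, ht.ite_left (hP.exists_unfolds C₁).choose_spec⟩)
    obtain ⟨hL₁, hq₁⟩ := ih₁ hC.2.1 (fun m hm => hroot m (Or.inl (Or.inr hm)))
      (fun m hm => hsm m (Or.inl (Or.inr hm))) (pending_self h₁ _) (hL ▸ hf₁)
    obtain ⟨hL₂, hq₂⟩ := ih₂ hC.2.2 (fun m hm => hroot m (Or.inr hm))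
      (fun m hm => hsm m (Or.inr hm)) (pending_self h₂ _) (hL ▸ hf₂)
    refine ⟨by simp [analyzeWith, AbsState.join, hL₁, hL₂, hL], fun q => ?_⟩
    rw [analyzeWith, AbsState.facts_join, Set.mem_union, hq₁, hq₂, hq, hL,
      reaches_ite hP hbal hi (pending_self h₁ k) (pending_self h₂ k), ← or_or_distrib_left, or_assoc]
  | loop C C' ih ih' =>
    obtain ⟨hi, h'⟩ := pending_loop hp
    obtain ⟨hL, hq⟩ := ih hC.1 (fun m hm => hroot m (Or.inl hm)) (fun m hm => hsm m (Or.inl hm)) hi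
      (fun t ht => hfit t ht.loop_exit)
    obtain ⟨hL', hq'⟩ := ih' hC.2 (fun m hm => hroot m (Or.inr hm)) (fun m hm => hsm m (Or.inr hm))
      (pending_self h' _) (hL ▸ hfit.loop_right hP hbal hi)
    refine ⟨by simp [analyzeWith, AbsState.join, hL', hL], fun q => ?_⟩
    -- The body is analyzed from the state after `C`, so the facts of that state occur on both sides
    -- of the join.
    rw [analyzeWith, AbsState.facts_join, Set.mem_union, hq', hq, hL,
      reaches_loop hP hbal hi (pending_self h' k), or_self_left, or_assoc]
  | call C m es ih =>
    replace hp : C.pending D.L = some k := hp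
    have hfC : Fits P Lhat C D.L := hfit.of_append fun t ht =>
      ⟨_, ht.call es (hP.exists_unfolds (P.body m)).choose_spec⟩
    have hfm := hfit.call_body hP hbal hp
    obtain ⟨hL, hq⟩ := ih hC.1 (fun m hm => hroot m (Or.inl hm)) (fun m hm => hsm m (Or.inl hm)) hp
      hfC
    -- The body fits from the call site's count `k`, hence also from `0`, which makes its summary
    -- exact.
    obtain ⟨hLm, hqm⟩ := hsm m (Or.inr rfl) fun t ht => (hfm t ht).anti (Nat.zero_le k)
    have hk : k ≤ Lhat := (hfm _ (hP.exists_unfolds (P.body m)).choose_spec).head_le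
    refine ⟨by simp [analyzeWith, applySummary, addLock, hL, hLm, hk], fun q => ?_⟩
    rw [analyzeWith, facts_applySummary, reaches_call hP hbal hp, Set.mem_union, hq, hL, or_assoc]
    · have : (sm m).facts = {p | Reaches P (P.body m) 0 0 p} := Set.ext hqm
      rw [this]
      rfl
    · intro q hq
      obtain ⟨i, hi, h⟩ := hroot m (Or.inr rfl) q hq
      exact ⟨i, h, hC.2 ▸ hi⟩
    · intro q hq
      obtain ⟨t, E, ht, hE, hqE⟩ := (hqm (.inr q)).1 (AbsState.inr_mem_facts.2 hq)
      rw [hL]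
      exact hE.access_le (by simpa using hfm t ht) hqE

/-! ### Exactness of method summaries. -/

theorem root_of_mem_facts_summary (hP : P.NonRecursive) (hwf : P.WellFormed) (Lhat : ℕ) (m : M) :
    ∀ q ∈ (summary P hP Lhat m).facts, q.root ∈ formals (P.arity m) := by
  induction m using hP.induction with
  | _ m ih =>
    intro q hq
    rw [summary_eq, analyze] at hq
    rcases CStmt.root_of_mem_facts_analyzeWith (hwf m).2.1 ih hq with hq | ⟨hq, i, hi⟩
    · simp at hq
    · exact ⟨i, (hwf m).1 i (hi ▸ hq), hi⟩

theorem summary_exact (hP : P.NonRecursive) (hwf : P.WellFormed)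
    (hbal : ∀ m, (P.body m).pending 0 = some 0) {Lhat : ℕ} (m : M)
    (hfit : Fits P Lhat (P.body m) 0) : (summary P hP Lhat m).L = 0 ∧
      ∀ q, q ∈ (summary P hP Lhat m).facts ↔ Reaches P (P.body m) 0 0 q := by
  induction m using hP.induction with
  | _ m ih =>
    rw [summary_eq, analyze]
    have := CStmt.analyzeWith_exact hP hbal (hwf m).2.1
      (fun m _ => root_of_mem_facts_summary hP hwf Lhat m) ih (D := .bot) (hbal m) hfit
    simpa [AbsState.bot] using this

/-- The analysis finds exactly the facts contributed by syntactic runs. -/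
theorem analyze_exact (hP : P.NonRecursive) (hwf : P.WellFormed)
    (hbal : ∀ m, (P.body m).pending 0 = some 0) {Lhat : ℕ} {C : CStmt F M} (hC : C.ArityOK P)
    {k : ℕ} (hp : C.pending 0 = some k) (hfit : Fits P Lhat C 0) :
    (analyze P hP Lhat C .bot).L = k ∧
      ∀ q, q ∈ (analyze P hP Lhat C .bot).facts ↔ Reaches P C 0 k q := by
  have := CStmt.analyzeWith_exact hP hbal hC
    (fun m _ => root_of_mem_facts_summary hP hwf Lhat m)
    (fun m _ => summary_exact hP hwf hbal m) (D := .bot) hp hfit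
  simp only [AbsState.facts_bot, Set.mem_empty_iff_false, false_or] at this
  exact this

end
end RacerDX
namespace RacerDX

/-! ### Syntactic and concrete runs -/

section
variable {F M : Type*}

/-- The commands of a trace. -/
def Trace.labels (τ : Trace F) : List (Label F) := τ.map Prod.fst

@[simp] theorem Trace.labels_append (τ τ' : Trace F) :
    Trace.labels (τ ++ τ') = Trace.labels τ ++ Trace.labels τ' := List.map_append

@[simp] theorem Trace.final_nil (κ : Config F) : Trace.final [] κ = κ := rfl

@[simp] theorem Trace.final_concat (τ : Trace F) (l : Label F) (κ κ' : Config F) :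
    Trace.final (τ ++ [(l, κ')]) κ = κ' := by simp [Trace.final]

@[simp] theorem Trace.final_singleton (l : Label F) (κ κ' : Config F) :
    Trace.final [(l, κ')] κ = κ' := rfl

@[simp] theorem Trace.final_append (τ τ' : Trace F) (κ : Config F) :
    Trace.final (τ ++ τ') κ = Trace.final τ' (Trace.final τ κ) := by
  rcases List.eq_nil_or_concat τ' with rfl | ⟨τ', ⟨l, κ'⟩, rfl⟩
  · simp
  · rw [List.concat_eq_append, ← List.append_assoc, Trace.final_concat, Trace.final_concat]

section
variable [Finite F]

theorem Stmt.labels_of_mem_traces {c : Stmt F} {κ : Config F} {τ : Trace F}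
    (h : τ ∈ c.traces κ) : Trace.labels τ = c.labels := by
  cases c
  case load x π =>
    obtain ⟨a, ℓ, -, -, rfl⟩ := h
    rfl
  case store π x =>
    obtain ⟨a, -, ha, rfl⟩ := h
    rfl
  case new x =>
    obtain ⟨ℓ, -, hℓ, rfl⟩ := h
    rfl
  case unlock =>
    obtain ⟨-, rfl⟩ := h
    rfl
  all_goals
    obtain rfl := h
    rfl

theorem Run.unfolds {P : Methods F M} {C : CStmt F M} {κ : Config F} {τ : Trace F}
    (h : Run P C κ τ) : Unfolds P C τ.labels := by
  induction h with
  | simple hτ => exact Stmt.labels_of_mem_traces hτ ▸ .simple _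
  | seq _ hτ' ih => rw [Trace.labels_append, Stmt.labels_of_mem_traces hτ']; exact ih.seq _
  | ite_left _ _ ih ih' => rw [Trace.labels_append]; exact ih.ite_left ih'
  | ite_right _ _ ih ih' => rw [Trace.labels_append]; exact ih.ite_right ih'
  | loop_exit _ ih => exact ih.loop_exit
  | loop_iter _ _ ih ih' => rw [Trace.labels_append]; exact ih.loop_iter ih'
  | @call _ _ es _ _ _ _ _ _ _ _ _ _ _ _ ih ih' =>
    have := ih.call es ih'
    simpa [Trace.labels] using this

theorem Stmt.bounded_of_mem_traces {Lhat : ℕ} {c : Stmt F} {κ : Config F} {τ : Trace F}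
    (h : τ ∈ c.traces κ) (hτ : ∀ σ ∈ τ, σ.2.locks ≤ Lhat) (hκ : κ.locks ≤ Lhat) :
    Bounded Lhat τ.labels κ.locks ∧ locksAfter τ.labels κ.locks = (τ.final κ).locks := by
  cases c
  case load x π =>
    obtain ⟨a, ℓ, -, -, rfl⟩ := h
    exact ⟨⟨hκ, hκ⟩, rfl⟩
  case store π x =>
    obtain ⟨a, -, ha, rfl⟩ := h
    exact ⟨⟨hκ, hκ⟩, rfl⟩
  case new x =>
    obtain ⟨ℓ, -, hℓ, rfl⟩ := h
    exact ⟨⟨hκ, hκ⟩, rfl⟩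
  case unlock =>
    obtain ⟨-, rfl⟩ := h
    exact ⟨⟨hκ, (Nat.sub_le _ _).trans hκ⟩, rfl⟩
  case skip =>
    obtain rfl := h
    exact ⟨hκ, rfl⟩
  case move x y =>
    obtain rfl := h
    exact ⟨⟨hκ, hκ⟩, rfl⟩
  case lock =>
    obtain rfl := h
    exact ⟨⟨hκ, hτ _ (List.mem_singleton_self _)⟩, rfl⟩

omit [Finite F] in
theorem Trace.final_locks_le {Lhat : ℕ} {κ : Config F} {τ : Trace F}
    (hτ : ∀ σ ∈ τ, σ.2.locks ≤ Lhat) (hκ : κ.locks ≤ Lhat) : (τ.final κ).locks ≤ Lhat := by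
  rcases List.eq_nil_or_concat τ with rfl | ⟨τ', ⟨l, κ'⟩, rfl⟩
  · exact hκ
  · rw [List.concat_eq_append, Trace.final_concat]
    exact hτ (l, κ') (by simp)

/-- The labels alone determine the lock counts of a run, so a bound on its recorded configurations
becomes a property of its command list. -/
theorem Run.bounded {P : Methods F M} {Lhat : ℕ} {C : CStmt F M} {κ : Config F} {τ : Trace F}
    (h : Run P C κ τ) (hτ : ∀ σ ∈ τ, σ.2.locks ≤ Lhat) (hκ : κ.locks ≤ Lhat) :
    Bounded Lhat τ.labels κ.locks ∧ locksAfter τ.labels κ.locks = (τ.final κ).locks := by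
  have comp : ∀ {κ : Config F} {τ τ' : Trace F}, (∀ σ ∈ τ ++ τ', σ.2.locks ≤ Lhat) →
      κ.locks ≤ Lhat →
      ((∀ σ ∈ τ, σ.2.locks ≤ Lhat) → κ.locks ≤ Lhat →
        Bounded Lhat τ.labels κ.locks ∧ locksAfter τ.labels κ.locks = (τ.final κ).locks) →
      ((∀ σ ∈ τ', σ.2.locks ≤ Lhat) → (τ.final κ).locks ≤ Lhat →
        Bounded Lhat τ'.labels (τ.final κ).locks ∧
          locksAfter τ'.labels (τ.final κ).locks = (τ'.final (τ.final κ)).locks) →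
      Bounded Lhat (Trace.labels (τ ++ τ')) κ.locks ∧
        locksAfter (Trace.labels (τ ++ τ')) κ.locks = (Trace.final (τ ++ τ') κ).locks := by
    intro κ τ τ' hτ hκ h h'
    have hl : ∀ σ ∈ τ, σ.2.locks ≤ Lhat := fun σ hσ => hτ σ (List.mem_append_left _ hσ)
    obtain ⟨h₁, h₂⟩ := h hl hκ
    obtain ⟨h₃, h₄⟩ := h' (fun σ hσ => hτ σ (List.mem_append_right _ hσ))
      (Trace.final_locks_le hl hκ)
    rw [Trace.labels_append, bounded_append, locksAfter_append, Trace.final_append, h₂]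
    exact ⟨⟨h₁, h₃⟩, h₄⟩
  induction h with
  | simple hc => exact Stmt.bounded_of_mem_traces hc hτ hκ
  | seq _ hc ih => exact comp hτ hκ ih (Stmt.bounded_of_mem_traces hc)
  | ite_left _ _ ih ih' => exact comp hτ hκ ih ih'
  | ite_right _ _ ih ih' => exact comp hτ hκ ih ih'
  | loop_exit _ ih => exact ih hτ hκ
  | loop_iter _ _ ih ih' => exact comp hτ hκ ih ih'
  | call _ _ e _ _ ih ih' =>
    -- The trace of a call is a left-nested concatenation of four pieces; `push` and `pop` keep the
    -- lock count.
    refine comp hτ hκ (fun hτ hκ => comp hτ hκ (fun hτ hκ => comp hτ hκ ih fun _ h => ?_) ?_) ?_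
    · subst e
      exact ⟨⟨h, h⟩, rfl⟩
    · rw [Trace.final_concat]
      exact ih'
    · rw [Trace.final_append, Trace.final_concat]
      exact fun _ h => ⟨⟨h, h⟩, rfl⟩

end

/-! ### Realizability of syntactic runs -/

/-- The variables in `X` hold allocated locations, and the heap is well-behaved. -/
structure Config.Good (X : Set Var) (κ : Config F) : Prop where
  frame : ∀ x ∈ X, κ.frame x ∈ κ.heap.locs
  heap : ∀ a ℓ, κ.heap.map a = some ℓ → ℓ ∈ κ.heap.locs
  fields : ∀ ℓ ∈ κ.heap.locs, ∀ f, (ℓ, f) ∈ κ.heap.dom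

theorem Config.Good.anti {X Y : Set Var} {κ : Config F} (h : κ.Good Y) (hXY : X ⊆ Y) : κ.Good X :=
  ⟨fun x hx => h.frame x (hXY hx), h.heap, h.fields⟩

theorem CStmt.subset_assigned (C : CStmt F M) (X : Set Var) : X ⊆ C.assigned X := by
  induction C generalizing X with
  | simple c => exact Set.subset_union_left
  | seq C c ih => exact (ih X).trans Set.subset_union_left
  | ite C C₁ C₂ ih ih₁ ih₂ =>
    exact Set.subset_inter ((ih X).trans (ih₁ _)) ((ih X).trans (ih₂ _))
  | loop C C' ih _ => exact ih X
  | call C m es ih => exact ih X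

theorem CStmt.assigned_univ (C : CStmt F M) : C.assigned Set.univ = Set.univ :=
  Set.univ_subset_iff.1 (C.subset_assigned _)

/-- The outermost program is not subject to definite assignment. In a well-behaved frame every
variable is allocated, so it may start with all variables assigned. -/
theorem CStmt.defAssign_univ (C : CStmt F M) : C.DefAssign Set.univ := by
  induction C with
  | simple c => exact Set.subset_univ _
  | seq C c ih => exact ⟨ih, (Set.subset_univ _).trans (C.subset_assigned _)⟩
  | ite C C₁ C₂ ih ih₁ ih₂ => simpa only [DefAssign, assigned_univ] using ⟨ih, ih₁, ih₂⟩
  | loop C C' ih ih' => simpa only [DefAssign, assigned_univ] using ⟨ih, ih'⟩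
  | call C m es ih => exact ⟨ih, fun e _ => C.subset_assigned _ (Set.mem_univ _)⟩

theorem Heap.exists_of_mem_dom {h : Heap F} {a : Loc × F} (ha : a ∈ h.dom) :
    ∃ ℓ, h.map a = some ℓ := Option.ne_none_iff_exists'.1 ha

/-- Each dereference along the path lands on an allocated object, which has every field, so
evaluation cannot get stuck. -/
theorem Config.Good.exists_lval {X : Set Var} {κ : Config F} (h : κ.Good X) (π : Path F)
    (hπ : π.root ∈ X) : ∃ a, π.lval κ.frame κ.heap = some a ∧ a ∈ κ.heap.dom := by
  induction π with
  | base x f => exact ⟨_, rfl, h.fields _ (h.frame x hπ) f⟩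
  | dot π f ih =>
    obtain ⟨a, ha, had⟩ := ih hπ
    obtain ⟨ℓ, hℓ⟩ := Heap.exists_of_mem_dom had
    exact ⟨(ℓ, f), by simp [Path.lval, ha, hℓ], h.fields _ (h.heap a ℓ hℓ) f⟩

theorem Config.Good.exists_eval {X : Set Var} {κ : Config F} (h : κ.Good X) (e : Exp F)
    (he : e.root ∈ X) : ∃ v ∈ κ.heap.locs, e.eval κ.frame κ.heap = some v := by
  cases e with
  | var x => exact ⟨_, h.frame x he, rfl⟩
  | path π =>
    obtain ⟨a, ha, had⟩ := h.exists_lval π he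
    obtain ⟨ℓ, hℓ⟩ := Heap.exists_of_mem_dom had
    exact ⟨ℓ, h.heap a ℓ hℓ, by simp [Exp.eval, ha, hℓ]⟩

theorem Config.Good.exists_evals {X : Set Var} {κ : Config F} (h : κ.Good X) {es : List (Exp F)}
    (he : ∀ e ∈ es, e.root ∈ X) :
    ∃ vs, List.Forall₂ (fun e v => Exp.eval κ.frame κ.heap e = some v) es vs ∧
      ∀ v ∈ vs, v ∈ κ.heap.locs := by
  induction es with
  | nil => exact ⟨[], .nil, by simp⟩
  | cons e es ih =>
    obtain ⟨v, hv, hev⟩ := h.exists_eval e (he e (by simp))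
    obtain ⟨vs, hvs, hl⟩ := ih fun e he' => he e (by simp [he'])
    exact ⟨v :: vs, .cons hev hvs, by simpa using ⟨hv, hl⟩⟩

/-! ### Heap updates and allocated locations. -/

theorem Heap.dom_write (h : Heap F) (a : Loc × F) (ha : a ∈ h.dom) (ℓ : Loc) :
    (h.write a ha ℓ).dom = h.dom := by
  classical
  ext b
  by_cases hb : b = a
  · subst hb
    exact iff_of_true (by simp [dom, write]) ha
  · simp [dom, write, Function.update_of_ne hb]

theorem Heap.locs_write (h : Heap F) (a : Loc × F) (ha : a ∈ h.dom) (ℓ : Loc) :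
    (h.write a ha ℓ).locs = h.locs := by rw [locs, dom_write, locs]

theorem Heap.dom_alloc [Finite F] (h : Heap F) (ℓ : Loc) (hℓ : ℓ ≠ nil) :
    (h.alloc ℓ hℓ).dom = {a | a.1 = ℓ} ∪ h.dom := by
  ext a
  by_cases ha : a.1 = ℓ <;> simp [dom, alloc, ha]

/-- Without any field a new object would have no cell and would not count as allocated. -/
theorem Heap.locs_alloc [Finite F] [Nonempty F] (h : Heap F) (ℓ : Loc) (hℓ : ℓ ≠ nil) :
    (h.alloc ℓ hℓ).locs = insert ℓ h.locs := by
  rw [locs, dom_alloc, Set.image_union, Set.insert_eq]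
  congr 1
  ext x
  simp [eq_comm]

theorem Heap.finite_locs (h : Heap F) : h.locs.Finite := h.finite_dom.image _

theorem Heap.exists_fresh (h : Heap F) : ∃ ℓ, ℓ ∉ h.locs ∧ ℓ ≠ nil := by
  obtain ⟨ℓ, hℓ⟩ := (h.finite_locs.insert nil).exists_notMem
  exact ⟨ℓ, fun h' => hℓ (Or.inr h'), fun h' => hℓ (Or.inl h')⟩

theorem Config.Good.set {X : Set Var} {κ : Config F} (h : κ.Good X) (x : Var) {ℓ : Loc}
    (hℓ : ℓ ∈ κ.heap.locs) : Config.Good (X ∪ {x}) { κ with frame := Store.set κ.frame x ℓ } := by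
  classical
  refine ⟨fun y hy => ?_, h.heap, h.fields⟩
  by_cases hyx : y = x
  · subst hyx
    simpa [Store.set] using hℓ
  · simpa [Store.set, Function.update_of_ne hyx] using h.frame y (hy.resolve_right hyx)

theorem Config.Good.write {X : Set Var} {κ : Config F} (h : κ.Good X) {a : Loc × F}
    (ha : a ∈ κ.heap.dom) {ℓ : Loc} (hℓ : ℓ ∈ κ.heap.locs) :
    Config.Good X { κ with heap := κ.heap.write a ha ℓ } := by
  classical
  refine ⟨fun x hx => ?_, fun b v hb => ?_, fun v hv f => ?_⟩
  · rw [Heap.locs_write]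
    exact h.frame x hx
  · rw [Heap.locs_write]
    by_cases hba : b = a
    · subst hba
      simp only [Heap.write, Function.update_self, Option.some.injEq] at hb
      exact hb ▸ hℓ
    · simp only [Heap.write, Function.update_of_ne hba] at hb
      exact h.heap b v hb
  · rw [Heap.locs_write] at hv
    rw [Heap.dom_write]
    exact h.fields v hv f

theorem Config.Good.alloc [Finite F] [Nonempty F] {X : Set Var} {κ : Config F} (h : κ.Good X)
    {ℓ : Loc} (hℓ : ℓ ≠ nil) : Config.Good X { κ with heap := κ.heap.alloc ℓ hℓ } := by
  refine ⟨fun x hx => ?_, fun b v hb => ?_, fun v hv f => ?_⟩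
  · rw [Heap.locs_alloc]
    exact Or.inr (h.frame x hx)
  · rw [Heap.locs_alloc]
    simp only [Heap.alloc] at hb
    split_ifs at hb
    · exact Or.inl (Option.some.inj hb).symm
    · exact Or.inr (h.heap b v hb)
  · rw [Heap.locs_alloc] at hv
    rw [Heap.dom_alloc]
    exact hv.imp id fun hv => h.fields v hv f

/-- The outcome of a terminating execution from `κ` with lock count `k` and assigned variables
`X` in the end. -/
structure Config.Outcome (X : Set Var) (k : ℕ) (κ κ' : Config F) : Prop where
  good : κ'.Good X
  locks : κ'.locks = k
  frames : κ'.frames = κ.frames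
  locs : κ.heap.locs ⊆ κ'.heap.locs

theorem Config.Outcome.trans {X Y : Set Var} {i k : ℕ} {κ κ' κ'' : Config F}
    (h : Config.Outcome X i κ κ') (h' : Config.Outcome Y k κ' κ'') : Config.Outcome Y k κ κ'' :=
  ⟨h'.good, h'.locks, h'.frames.trans h.frames, h.locs.trans h'.locs⟩

theorem Config.Outcome.anti {X Y : Set Var} {k : ℕ} {κ κ' : Config F}
    (h : Config.Outcome Y k κ κ') (hXY : X ⊆ Y) : Config.Outcome X k κ κ' :=
  ⟨h.good.anti hXY, h.locks, h.frames, h.locs⟩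

theorem Stmt.exists_trace [Finite F] [Nonempty F] {c : Stmt F} {X : Set Var} {κ : Config F} {k : ℕ}
    (hκ : κ.Good X) (hc : c.uses ⊆ X) (hp : c.pending κ.locks = some k) :
    ∃ τ ∈ c.traces κ, Config.Outcome (X ∪ c.assigns) k κ (τ.final κ) := by
  cases c with
  | skip =>
    cases hp
    exact ⟨[], rfl, by simpa [assigns] using hκ, rfl, rfl, subset_rfl⟩
  | move x y =>
    cases hp
    exact ⟨_, rfl, hκ.set x (hκ.frame y (hc rfl)), rfl, rfl, subset_rfl⟩
  | load x π =>
    cases hp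
    obtain ⟨a, ha, had⟩ := hκ.exists_lval π (hc rfl)
    obtain ⟨ℓ, hℓ⟩ := Heap.exists_of_mem_dom had
    exact ⟨_, ⟨a, ℓ, ha, hℓ, rfl⟩, hκ.set x (hκ.heap a ℓ hℓ), rfl, rfl, subset_rfl⟩
  | store π x =>
    cases hp
    obtain ⟨a, ha, had⟩ := hκ.exists_lval π (hc (Or.inl rfl))
    refine ⟨_, ⟨a, ha, had, rfl⟩, ?_, rfl, rfl, ?_⟩
    · simpa [assigns] using hκ.write had (hκ.frame x (hc (Or.inr rfl)))
    · exact (Heap.locs_write κ.heap a had _).ge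
  | new x =>
    cases hp
    obtain ⟨ℓ, hℓ, hℓ'⟩ := κ.heap.exists_fresh
    have hl := κ.heap.locs_alloc ℓ hℓ'
    exact ⟨_, ⟨ℓ, hℓ, hℓ', rfl⟩, (hκ.alloc hℓ').set x (hl ▸ Or.inl rfl), rfl, rfl,
      hl ▸ Set.subset_insert _ _⟩
  | lock =>
    cases hp
    exact ⟨_, rfl, by simpa [assigns] using ⟨hκ.frame, hκ.heap, hκ.fields⟩, rfl, rfl, subset_rfl⟩
  | unlock =>
    have hpos : 0 < κ.locks := by
      rcases hL : κ.locks with _ | n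
      · simp [hL, pending] at hp
      · exact n.succ_pos
    have hk : κ.locks - 1 = k := by
      rcases hL : κ.locks with _ | n
      · omega
      · simpa [hL, pending] using hp
    exact ⟨_, ⟨hpos, rfl⟩, by simpa [assigns] using ⟨hκ.frame, hκ.heap, hκ.fields⟩, hk, rfl,
      subset_rfl⟩

theorem calleeFrame_mem {vs : List Loc} {A : Set Loc} (h : ∀ v ∈ vs, v ∈ A) :
    ∀ x ∈ formals vs.length, calleeFrame vs x ∈ A := by
  rintro _ ⟨i, hi, rfl⟩
  simpa [calleeFrame, hi] using h _ (List.getElem_mem hi)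

/-- Every syntactic run is realized from every good configuration. -/
theorem Unfolds.exists_run [Finite F] [Nonempty F] {P : Methods F M} (hwf : P.WellFormed)
    (hbal : ∀ m, (P.body m).pending 0 = some 0) {C : CStmt F M} {t : List (Label F)}
    (h : Unfolds P C t) (hC : C.ArityOK P) {X : Set Var} (hX : C.DefAssign X) {κ : Config F}
    (hκ : κ.Good X) {k : ℕ} (hp : C.pending κ.locks = some k) :
    ∃ τ, Run P C κ τ ∧ τ.labels = t ∧ Config.Outcome (C.assigned X) k κ (τ.final κ) := by
  induction h generalizing X κ k with
  | simple c =>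
    obtain ⟨τ, hτ, ho⟩ := Stmt.exists_trace hκ hX hp
    exact ⟨τ, .simple hτ, Stmt.labels_of_mem_traces hτ, ho⟩
  | seq c _ ih =>
    obtain ⟨i, hi, hc⟩ := CStmt.pending_seq hp
    obtain ⟨τ, hτ, rfl, ho⟩ := ih hC hX.1 hκ hi
    obtain ⟨τ', hτ', ho'⟩ := Stmt.exists_trace ho.good hX.2 (ho.locks ▸ hc)
    refine ⟨τ ++ τ', .seq hτ hτ', ?_, ?_⟩
    · rw [Trace.labels_append, Stmt.labels_of_mem_traces hτ']
    · rw [Trace.final_append]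
      exact ho.trans ho'
  | ite_left _ _ ih ih' =>
    obtain ⟨hi, h₁, -⟩ := CStmt.pending_ite hp
    obtain ⟨τ, hτ, rfl, ho⟩ := ih hC.1 hX.1 hκ hi
    obtain ⟨τ', hτ', rfl, ho'⟩ := ih' hC.2.1 hX.2.1 ho.good (CStmt.pending_self h₁ _)
    refine ⟨τ ++ τ', .ite_left hτ hτ', Trace.labels_append _ _, ?_⟩
    rw [Trace.final_append, ← ho.locks]
    exact ho.trans (ho'.anti Set.inter_subset_left)
  | ite_right _ _ ih ih' =>
    obtain ⟨hi, -, h₂⟩ := CStmt.pending_ite hp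
    obtain ⟨τ, hτ, rfl, ho⟩ := ih hC.1 hX.1 hκ hi
    obtain ⟨τ', hτ', rfl, ho'⟩ := ih' hC.2.2 hX.2.2 ho.good (CStmt.pending_self h₂ _)
    refine ⟨τ ++ τ', .ite_right hτ hτ', Trace.labels_append _ _, ?_⟩
    rw [Trace.final_append, ← ho.locks]
    exact ho.trans (ho'.anti Set.inter_subset_right)
  | loop_exit _ ih =>
    obtain ⟨τ, hτ, rfl, ho⟩ := ih hC.1 hX.1 hκ (CStmt.pending_loop hp).1
    exact ⟨τ, .loop_exit hτ, rfl, ho⟩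
  | loop_iter _ _ ih ih' =>
    obtain ⟨τ, hτ, rfl, ho⟩ := ih hC hX hκ hp
    obtain ⟨τ', hτ', rfl, ho'⟩ := ih' hC.2 hX.2 ho.good
      (CStmt.pending_self (CStmt.pending_loop hp).2 _)
    refine ⟨τ ++ τ', .loop_iter hτ hτ', Trace.labels_append _ _, ?_⟩
    rw [Trace.final_append, ← ho.locks]
    -- A loop counts only the assignments of `C`; what the body assigns in addition is forgotten.
    exact ho.trans (ho'.anti (CStmt.subset_assigned _ _))
  | @call C m t t' es _ _ ih ih' =>
    obtain ⟨τ, hτ, rfl, ho⟩ := ih hC.1 hX.1 hκ hp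
    obtain ⟨vs, hvs, hl⟩ := ho.good.exists_evals hX.2
    -- Locals of the callee start as `nil`, which is never allocated, so only the formals are good;
    -- definite assignment of the body bridges the gap.
    have hκ₀ : Config.Good (formals (P.arity m)) { τ.final κ with
        frame := calleeFrame vs, frames := (τ.final κ).frame :: (τ.final κ).frames } := by
      refine ⟨?_, ho.good.heap, ho.good.fields⟩
      rw [← hC.2, hvs.length_eq]
      exact calleeFrame_mem hl
    obtain ⟨τ', hτ', rfl, ho'⟩ := ih' (hwf m).2.1 (hwf m).2.2 hκ₀ (CStmt.pending_self (hbal m) _)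
    refine ⟨_, .call hτ hvs rfl hτ' ho'.frames, by simp [Trace.labels], ?_⟩
    rw [Trace.final_concat]
    -- The restored caller frame remains good because allocated locations are never freed.
    exact ⟨⟨fun x hx => ho'.locs (ho.good.frame x hx), ho'.good.heap, ho'.good.fields⟩,
      ho'.locks.trans ho.locks, ho.frames, ho.locs.trans ho'.locs⟩

theorem WellBehaved.good {s : Store} {S : List Store} {h : Heap F} (hwb : WellBehaved (s :: S) h)
    (L : ℕ) : Config.Good Set.univ ⟨s, S, h, L⟩ :=
  ⟨fun x _ => hwb.1 s (by simp) x, hwb.2.1, hwb.2.2⟩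

/-- Any variable of the frame holds an allocated location, and an allocated location owns a cell,
whose address names a field. -/
theorem WellBehaved.nonempty {s : Store} {S : List Store} {h : Heap F}
    (hwb : WellBehaved (s :: S) h) : Nonempty F :=
  let ⟨a, _⟩ := hwb.1 s (by simp) (.arg 0)
  ⟨a.2⟩

end
end RacerDX

/-! ### The completeness theorem. -/

theorem theorem1 {F M : Type*} [Finite F]
    (P : RacerDX.Methods F M) (hP : P.NonRecursive) (hwf : P.WellFormed) (hanf : P.ANF)
    (C : RacerDX.CStmt F M) (hC : C.ArityOK P) (hbal : RacerDX.BalancedLocking P C)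
    (s : RacerDX.Store) (S : List RacerDX.Store) (h : RacerDX.Heap F)
    (hwb : RacerDX.WellBehaved (s :: S) h)
    (Lhat : ℕ)
    (hLhat : ∀ τ ∈ RacerDX.traces P C ⟨s, S, h, 0⟩, ∀ σ ∈ τ, σ.2.locks ≤ Lhat) :
    RacerDX.analyze P hP Lhat C RacerDX.AbsState.bot =
      RacerDX.abstraction Lhat (RacerDX.traces P C ⟨s, S, h, 0⟩) := by
  open RacerDX in
  obtain ⟨⟨k, hk⟩, hbody⟩ := hbal
  have := hwb.nonempty
  have hrun : ∀ t, Unfolds P C t → ∃ τ ∈ traces P C ⟨s, S, h, 0⟩, Trace.labels τ = t := fun t ht =>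
    let ⟨τ, hτ, hl, _⟩ := ht.exists_run hwf hbody hC C.defAssign_univ (hwb.good 0) hk
    ⟨τ, hτ, hl⟩
  have hbounded : ∀ τ ∈ traces P C ⟨s, S, h, 0⟩, Bounded Lhat (Trace.labels τ) 0 := fun τ hτ =>
    (Run.bounded hτ (hLhat τ hτ) (Nat.zero_le _)).1
  -- The bound is assumed for concrete traces only; realizability extends it to all control paths.
  have hfit : Fits P Lhat C 0 := fun t ht => by
    obtain ⟨τ, hτ, rfl⟩ := hrun t ht
    exact hbounded τ hτ
  have habs : ∀ τ ∈ traces P C ⟨s, S, h, 0⟩, ∀ E, Steps ([], 0) (Trace.labels τ) E ([], k) →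
      (Trace.abs Lhat τ).L = k ∧ (Trace.abs Lhat τ).facts = E := fun τ hτ E hE => by
    have := hE.exec (hbounded τ hτ) (D := .bot) rfl
    rwa [AbsState.facts_bot, Set.empty_union] at this
  obtain ⟨hL, hfacts⟩ := analyze_exact hP hwf hbody hC hk hfit
  have key : ∀ q, q ∈ (analyze P hP Lhat C .bot).facts ↔
      ∃ τ ∈ traces P C ⟨s, S, h, 0⟩, q ∈ (Trace.abs Lhat τ).facts := fun q => by
    rw [hfacts]
    constructor
    · rintro ⟨t, E, ht, hE, hq⟩
      obtain ⟨τ, hτ, rfl⟩ := hrun t ht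
      exact ⟨τ, hτ, (habs τ hτ E hE).2 ▸ hq⟩
    · rintro ⟨τ, hτ, hq⟩
      obtain ⟨E, hE⟩ := (Run.unfolds hτ).exists_steps hbody hk
      exact ⟨_, E, Run.unfolds hτ, hE, (habs τ hτ E hE).2 ▸ hq⟩
  -- Balanced locking gives all traces the same final count. At least one trace must exist, since
  -- the supremum of the empty set would be `0`.
  have hsup : (fun τ => (Trace.abs Lhat τ).L) '' traces P C ⟨s, S, h, 0⟩ = {k} := by
    refine Set.eq_singleton_iff_nonempty_unique_mem.2 ⟨?_, ?_⟩
    · obtain ⟨t, ht⟩ := hP.exists_unfolds C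
      obtain ⟨τ, hτ, -⟩ := hrun t ht
      exact ⟨_, τ, hτ, rfl⟩
    · rintro _ ⟨τ, hτ, rfl⟩
      obtain ⟨E, hE⟩ := (Run.unfolds hτ).exists_steps hbody hk
      exact (habs τ hτ E hE).1
  ext q
  · simpa [abstraction] using key (.inl q)
  · simp only [abstraction, hsup, csSup_singleton, hL]
  · simpa [abstraction] using key (.inr q)
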